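/- **Setting.** A server is connected to $U\ge 2$ relays; relay $u\in[U]$ is connected to the cluster $\mathcal K_u=\{(u,v)\}_{v\in[V_u]}$ of $V_u$ users. Let $\mathcal K=\bigcup_u\mathcal K_u$, $K=|\mathcal K|=\sum_uV_u$ and $\mathcal K_{\mathcal R}=\bigcup_{u\in\mathcal R}\mathcal K_u$ for $\mathcal R\subseteq[U]$. Let $\boldsymbol{\mathcal S}=\{\mathcal S_1,\dots,\mathcal S_M\}$ (security input sets) and $\boldsymbol{\mathcal T}=\{\mathcal T_1,\dots,\mathcal T_N\}$ (collusion sets) be non-empty families of subsets of $\mathcal K$, both closed under taking subsets, with $|\mathcal T_n|\le K-2$ for all $n$. Let $\mathbb F_q$ be a finite field; all entropies are in $q$-ary units. A *scheme* consists of an input length $L\ge1$ and finitely-valued random variables: inputs $W_{u,v}$, each uniform on $\mathbb F_q^{L}$; a source key $Z_\Sigma$ of $L_{Z_\Sigma}$ i.i.d. uniform symbols of $\mathbb F_q$; individual keys $Z_{u,v}$; messages $X_{u,v}\in\mathbb F_q^{L_X}$ from the users to the relays and $Y_u\in\mathbb F_q^{L_Y}$ from the relays to the server, such that - $H(\{W_{u,v}\},\{Z_{u,v}\})=\sum_{(u,v)\in\mathcal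 K}H(W_{u,v})+H(\{Z_{u,v}\})$ and $H(\{Z_{u,v}\}\mid Z_\Sigma)=0$; - $H(X_{u,v}\mid W_{u,v},Z_{u,v})=0$ and $H(Y_u\mid\{X_{u,v}\}_{v\in[V_u]})=0$ for all $(u,v)$, resp. all $u$; - (recovery) $H\big(\sum_{(u,v)\in\mathcal K}W_{u,v}\mid\{Y_u\}_{u\in[U]}\big)=0$; - (server security) $I\big(\{Y_u\}_{u\in[U]};\{W_{u,v}\}_{\mathcal S_m}\mid\sum_{(u,v)\in\mathcal K}W_{u,v},\{W_{i,j},Z_{i,j}\}_{\mathcal T_n}\big)=0$ for all $m,n$; - (relay security) $I\big(\{X_{u,v}\}_{v\in[V_u]};\{W_{u,v}\}_{\mathcal S_m}\mid\{W_{i,j},Z_{i,j}\}_{\mathcal T_n}\big)=0$ for all $u,m,n$. Its total key rate is $R_{Z_\Sigma}=H(Z_\Sigma)/L$, and $R^*_{Z_\Sigma}$ is the infimum of the total key rates of all schemes. **Combinatorial quantities.** Put $\mathcal U^{(m,n)}=\{u:\mathcal S_m\cap\mathcal K_u\ne\emptyset,\ |(\mathcal S_m\cup\mathcal T_n)\cap\mathcal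 K_u|=V_u\}$, $\mathcal B_{u,m,n}=(\mathcal S_m\cap\mathcal K_u)\cup\mathcal T_n$ and $\mathcal C_{m,n}=\mathcal K_{\mathcal U^{(m,n)}}\cup\mathcal T_n$. Let $$\mathcal S_{I}=\Big(\bigcup_{u,m,n:\,|\mathcal B_{u,m,n}|=K-1}\mathcal K\setminus\mathcal B_{u,m,n}\ \cup\bigcup_{m,n:\,|\mathcal C_{m,n}|=K-1}\mathcal K\setminus\mathcal C_{m,n}\Big)\setminus\bigcup_m\mathcal S_m,\qquad \overline{\mathcal S}=\bigcup_m\mathcal S_m\cup\mathcal S_I,$$ $\mathcal A_{u,m,n}=\mathcal B_{u,m,n}\cap\overline{\mathcal S}$, $\mathcal E_{m,n}=\mathcal C_{m,n}\cap\overline{\mathcal S}$, $a^*=\max_{u,m,n}|\mathcal A_{u,m,n}|$, $e^*=\max_{m,n}|\mathcal E_{m,n}|$, and $$d^*=\max_{m,n:\ \mathcal S_m\cap\mathcal T_n=\emptyset}\big(|\mathcal U^{(m,n)}|+|\mathcal T_n\cap\overline{\mathcal S}|\big).$$ Let $\mathcal Q=\mathcal Q_1\cup\mathcal Q_2\cup\mathcal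 Q_3$, where $\mathcal Q_1$ is the union of the $\mathcal B_{u,m,n}$ with $|\mathcal A_{u,m,n}|=|\overline{\mathcal S}|$, $\mathcal Q_2$ is the union of the $\mathcal C_{m,n}$ with $|\mathcal E_{m,n}|=|\overline{\mathcal S}|$, and $\mathcal Q_3$ is the union of the $\mathcal C_{m,n}$ with $\mathcal S_m\cap\mathcal T_n=\emptyset$ and $|\mathcal U^{(m,n)}|+|\mathcal T_n\cap\overline{\mathcal S}|=\max\{a^*,d^*\}$. **Theorem.** Suppose (Condition 3) that $a^*\le K-1$, $|\mathcal C_{m,n}|\le K-1$ for all $m,n$, $\max\{a^*,e^*\}=|\overline{\mathcal S}|$, $|\mathcal Q|=K$, and $a^*\le e^*=|\overline{\mathcal S}|$. Let $l^*$ be the optimal value of the linear program in the variables $\{l_{u,v}\}_{(u,v)\in\mathcal K}$ $$\min\sum_{(u,v)\in\mathcal K\setminus\overline{\mathcal S}}l_{u,v}\quad\text{s.t.}\quad\begin{cases}\sum_{(u',v)\in\mathcal K\setminus\mathcal B_{u,m,n}}l_{u',v}\ge1&\forall u,m,n\text{ with }|\mathcal A_{u,m,n}|=|\overline{\mathcal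 S}|,\\ \sum_{(u,v)\in\mathcal K\setminus\mathcal C_{m,n}}l_{u,v}\ge1&\forall m,n\text{ with }|\mathcal E_{m,n}|=|\overline{\mathcal S}|,\\ l_{u,v}\ge0&\forall(u,v)\in\mathcal K\setminus\overline{\mathcal S}.\end{cases}$$ Then the minimum $l^*$ is attained, schemes exist, and $$\max\{a^*,d^*\}\le R^*_{Z_\Sigma}\le\max\{a^*,d^*\}+l^*.$$ Consequently the key rate $\max\{a^*,d^*\}+l^*$ is within a factor $2$ of optimal: if some $\mathcal S_m$ is non-empty, then $\max\{a^*,d^*\}+l^*\le2R^*_{Z_\Sigma}$. -/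

import Mathlib

namespace WSHSA

universe u

/-! Entropy (in `q`-ary units) of finitely-valued random variables on a discrete
probability space. -/

/-- Shannon entropy `H(f)` in base `q`. -/
noncomputable def entropy {Ω α : Type*} [Fintype α] (q : ℕ) (μ : PMF Ω) (f : Ω → α) : ℝ :=
  ∑ a, Real.negMulLog ((μ.map f) a).toReal / Real.log q

/-- Conditional entropy `H(f | g) = H(f, g) - H(g)`. -/
noncomputable def condEntropy {Ω α β : Type*} [Fintype α] [Fintype β] (q : ℕ) (μ : PMF Ω)
    (f : Ω → α) (g : Ω → β) : ℝ :=
  entropy q μ (fun ω => (f ω, g ω)) - entropy q μ g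

/-- Conditional mutual information `I(f; g | h) = H(f | h) - H(f | g, h)`. -/
noncomputable def condMutualInfo {Ω α β γ : Type*} [Fintype α] [Fintype β] [Fintype γ] (q : ℕ)
    (μ : PMF Ω) (f : Ω → α) (g : Ω → β) (h : Ω → γ) : ℝ :=
  condEntropy q μ f h - condEntropy q μ f (fun ω => (g ω, h ω))

/-- The joint random variable `{f_i}_{i ∈ A}`. -/
def joint {Ω ι : Type*} {α : ι → Type*} (A : Finset ι) (f : (i : ι) → Ω → α i) :
    Ω → ((i : A) → α i) :=
  fun ω i => f i ω

/-! The network. -/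

/-- The users: the pair `⟨u, v⟩` is the `v`-th user of the cluster of relay `u`. -/
abbrev User {U : ℕ} (V : Fin U → ℕ) : Type := (u : Fin U) × Fin (V u)

/-- The total number `K` of users. -/
def numUsers {U : ℕ} (V : Fin U → ℕ) : ℕ := ∑ u, V u

/-- The cluster of relay `u`. -/
def cluster {U : ℕ} (V : Fin U → ℕ) (u : Fin U) : Finset (User V) :=
  Finset.univ.filter fun i => i.1 = u

/-- The union of the clusters of the relays in `R`. -/
def clusters {U : ℕ} (V : Fin U → ℕ) (R : Finset (Fin U)) : Finset (User V) :=
  R.biUnion (cluster V)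

/-- A weakly-secure hierarchical secure aggregation scheme with inputs of `L` symbols of `F`,
for the security input sets `𝒮` and the collusion sets `𝒯`. -/
structure Scheme (F : Type u) [Field F] [Fintype F] {U : ℕ} (V : Fin U → ℕ)
    (𝒮 𝒯 : Finset (Finset (User V))) where
  /-- the underlying discrete probability space -/
  Ω : Type u
  μ : PMF Ω
  /-- input length, source key length and message lengths -/
  L : ℕ
  LZ : ℕ
  LX : ℕ
  LY : ℕ
  L_pos : 0 < L
  /-- the inputs -/
  W : User V → Ω → (Fin L → F)
  /-- the source key -/
  Zsrc : Ω → (Fin LZ → F)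
  /-- the individual keys, with arbitrary finite alphabets -/
  Key : User V → Type u
  [keyFintype : (i : User V) → Fintype (Key i)]
  Z : (i : User V) → Ω → Key i
  /-- the messages from the users to the relays -/
  X : User V → Ω → (Fin LX → F)
  /-- the messages from the relays to the server -/
  Y : Fin U → Ω → (Fin LY → F)
  /-- each input consists of `L` i.i.d. uniform symbols -/
  W_uniform : ∀ i, μ.map (W i) = PMF.uniformOfFintype (Fin L → F)
  /-- the source key consists of `LZ` i.i.d. uniform symbols -/
  Zsrc_uniform : μ.map Zsrc = PMF.uniformOfFintype (Fin LZ → F)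
  /-- the inputs are independent of each other and of the keys -/
  indep : entropy (Fintype.card F) μ (fun ω => (joint Finset.univ W ω, joint Finset.univ Z ω))
    = (∑ i, entropy (Fintype.card F) μ (W i)) + entropy (Fintype.card F) μ (joint Finset.univ Z)
  /-- the individual keys are generated from the source key -/
  key_gen : condEntropy (Fintype.card F) μ (joint Finset.univ Z) Zsrc = 0
  /-- the first hop -/
  msgX : ∀ i, condEntropy (Fintype.card F) μ (X i) (fun ω => (W i ω, Z i ω)) = 0
  /-- the second hop -/
  msgY : ∀ u, condEntropy (Fintype.card F) μ (Y u) (joint (cluster V u) X) = 0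
  /-- the server recovers the sum of the inputs -/
  recovery : condEntropy (Fintype.card F) μ (fun ω => ∑ i, W i ω) (joint Finset.univ Y) = 0
  /-- server security -/
  server_security : ∀ S ∈ 𝒮, ∀ T ∈ 𝒯,
    condMutualInfo (Fintype.card F) μ (joint Finset.univ Y) (joint S W)
      (fun ω => (∑ i, W i ω, joint T W ω, joint T Z ω)) = 0
  /-- relay security -/
  relay_security : ∀ u, ∀ S ∈ 𝒮, ∀ T ∈ 𝒯,
    condMutualInfo (Fintype.card F) μ (joint (cluster V u) X) (joint S W)
      (fun ω => (joint T W ω, joint T Z ω)) = 0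

/-- The total key rate of a scheme: the entropy of the source key over the input length. -/
noncomputable def Scheme.keyRate {F : Type u} [Field F] [Fintype F] {U : ℕ} {V : Fin U → ℕ}
    {𝒮 𝒯 : Finset (Finset (User V))} (s : Scheme F V 𝒮 𝒯) : ℝ :=
  entropy (Fintype.card F) s.μ s.Zsrc / s.L

/-- The set of achievable total key rates. -/
def achievableKeyRates (F : Type u) [Field F] [Fintype F] {U : ℕ} (V : Fin U → ℕ)
    (𝒮 𝒯 : Finset (Finset (User V))) : Set ℝ :=
  Set.range fun s : Scheme F V 𝒮 𝒯 => s.keyRate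

/-- The optimal total key rate. -/
noncomputable def optimalKeyRate (F : Type u) [Field F] [Fintype F] {U : ℕ} (V : Fin U → ℕ)
    (𝒮 𝒯 : Finset (Finset (User V))) : ℝ :=
  sInf (achievableKeyRates F V 𝒮 𝒯)

/-! Combinatorial quantities of the security input sets and the collusion sets. -/

section Combinatorics

variable {U : ℕ} (V : Fin U → ℕ)

/-- The relays whose clusters meet `S` and are fully covered by `S ∪ T`. -/
def securityRelays (S T : Finset (User V)) : Finset (Fin U) :=
  Finset.univ.filter fun u =>
    (S ∩ cluster V u).card ≠ 0 ∧ ((S ∪ T) ∩ cluster V u).card = V u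

/-- `(S ∩ K_u) ∪ T`. -/
def relayCover (u : Fin U) (S T : Finset (User V)) : Finset (User V) :=
  (S ∩ cluster V u) ∪ T

/-- The users in `T` or in the cluster of a security relay of `(S, T)`. -/
def serverCover (S T : Finset (User V)) : Finset (User V) :=
  clusters V (securityRelays V S T) ∪ T

/-- The union of the (explicit) security input sets. -/
def explicitSet (𝒮 : Finset (Finset (User V))) : Finset (User V) :=
  𝒮.biUnion id

variable (𝒮 𝒯 : Finset (Finset (User V)))

/-- The index set of all `(u, S, T)`. -/
def triples : Finset (Fin U × Finset (User V) × Finset (User V)) :=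
  Finset.univ ×ˢ 𝒮 ×ˢ 𝒯

/-- The implicit relay security input set. -/
def implicitRelaySet : Finset (User V) :=
  ((triples V 𝒮 𝒯).filter fun p =>
      (relayCover V p.1 p.2.1 p.2.2).card + 1 = numUsers V).biUnion
    (fun p => (relayCover V p.1 p.2.1 p.2.2)ᶜ) \ explicitSet V 𝒮

/-- The implicit server security input set. -/
def implicitServerSet : Finset (User V) :=
  ((𝒮 ×ˢ 𝒯).filter fun p => (serverCover V p.1 p.2).card + 1 = numUsers V).biUnion
    (fun p => (serverCover V p.1 p.2)ᶜ) \ explicitSet V 𝒮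

/-- The total security input set. -/
def totalSet : Finset (User V) :=
  explicitSet V 𝒮 ∪ (implicitRelaySet V 𝒮 𝒯 ∪ implicitServerSet V 𝒮 𝒯)

/-- The part of `(S ∩ K_u) ∪ T` in the total security input set. -/
def setA (u : Fin U) (S T : Finset (User V)) : Finset (User V) :=
  relayCover V u S T ∩ totalSet V 𝒮 𝒯

/-- The part of the server cover of `(S, T)` in the total security input set. -/
def setE (S T : Finset (User V)) : Finset (User V) :=
  serverCover V S T ∩ totalSet V 𝒮 𝒯

def aStar : ℕ := (triples V 𝒮 𝒯).sup fun p => (setA V 𝒮 𝒯 p.1 p.2.1 p.2.2).card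

def eStar : ℕ := (𝒮 ×ˢ 𝒯).sup fun p => (setE V 𝒮 𝒯 p.1 p.2).card

/-- The pairs `(S, T)` with `S` and `T` disjoint. -/
def disjointPairs : Finset (Finset (User V) × Finset (User V)) :=
  (𝒮 ×ˢ 𝒯).filter fun p => p.1 ∩ p.2 = ∅

/-- The number of security relays of `(S, T)` plus the number of colluding users in the total
security input set. -/
def dValue (S T : Finset (User V)) : ℕ :=
  (securityRelays V S T).card + (T ∩ totalSet V 𝒮 𝒯).card

def dStar : ℕ := (disjointPairs V 𝒮 𝒯).sup fun p => dValue V 𝒮 𝒯 p.1 p.2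

def setQ₁ : Finset (User V) :=
  ((triples V 𝒮 𝒯).filter fun p =>
      (setA V 𝒮 𝒯 p.1 p.2.1 p.2.2).card = (totalSet V 𝒮 𝒯).card).biUnion
    fun p => relayCover V p.1 p.2.1 p.2.2

def setQ₂ : Finset (User V) :=
  ((𝒮 ×ˢ 𝒯).filter fun p =>
      (setE V 𝒮 𝒯 p.1 p.2).card = (totalSet V 𝒮 𝒯).card).biUnion
    fun p => serverCover V p.1 p.2

def setQ₃ : Finset (User V) :=
  ((disjointPairs V 𝒮 𝒯).filter fun p =>
      dValue V 𝒮 𝒯 p.1 p.2 = max (aStar V 𝒮 𝒯) (dStar V 𝒮 𝒯)).biUnion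
    fun p => serverCover V p.1 p.2

def setQ : Finset (User V) := setQ₁ V 𝒮 𝒯 ∪ setQ₂ V 𝒮 𝒯 ∪ setQ₃ V 𝒮 𝒯

/-- The parameter regime of the theorem. -/
structure Condition3 : Prop where
  aStar_lt : aStar V 𝒮 𝒯 < numUsers V
  cover_lt : ∀ S ∈ 𝒮, ∀ T ∈ 𝒯, (serverCover V S T).card < numUsers V
  max_eq : max (aStar V 𝒮 𝒯) (eStar V 𝒮 𝒯) = (totalSet V 𝒮 𝒯).card
  card_Q : (setQ V 𝒮 𝒯).card = numUsers V
  aStar_le : aStar V 𝒮 𝒯 ≤ eStar V 𝒮 𝒯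
  eStar_eq : eStar V 𝒮 𝒯 = (totalSet V 𝒮 𝒯).card

/-- Feasibility for the covering linear program. -/
structure LPFeasible (l : User V → ℝ) : Prop where
  relay : ∀ u, ∀ S ∈ 𝒮, ∀ T ∈ 𝒯, (setA V 𝒮 𝒯 u S T).card = (totalSet V 𝒮 𝒯).card →
    1 ≤ ∑ i ∈ (relayCover V u S T)ᶜ, l i
  server : ∀ S ∈ 𝒮, ∀ T ∈ 𝒯, (setE V 𝒮 𝒯 S T).card = (totalSet V 𝒮 𝒯).card →
    1 ≤ ∑ i ∈ (serverCover V S T)ᶜ, l i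
  nonneg : ∀ i ∈ (totalSet V 𝒮 𝒯)ᶜ, 0 ≤ l i

/-- The objective values of the feasible points of the linear program. -/
def lpValues : Set ℝ :=
  {x | ∃ l : User V → ℝ, LPFeasible V 𝒮 𝒯 l ∧ x = ∑ i ∈ (totalSet V 𝒮 𝒯)ᶜ, l i}

/-- The optimal value of the linear program. -/
noncomputable def lStar : ℝ := sInf (lpValues V 𝒮 𝒯)

end Combinatorics

end WSHSA

/-! Lower bounds. All entropies of a scheme form a monotone submodular function on subsets of its
variables (`SchemeEntropy`), and the converse is pure calculus with that function. By recovery, a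
user's message determines its input once its key is known, and a relay's message determines any one
input of its cluster once the cluster's keys and other inputs are known. By security, the same
messages say nothing about the inputs of `S` to the colluders `T`. So the keys of the protected
users must carry fresh entropy given the keys of `T`: `L` per protected user against a relay
(`relay_keys`), `L` per security relay against the server (`server_keys`). The keys of `T`
themselves carry `L` per user of `T` in the total security set (`colluding_keys`). Adding up gives
`aStar` and `dStar` as lower bounds for the rate.

The keys outside a cover must also hold `L` units unknown to `T` (`relay_edge`, `server_edge`),
since they complete the recovery of an input that is hidden without them. The chain-rule increments
of the key entropy outside the total set, divided by `L`, are therefore feasible for the linear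
program (`exists_lpValue_le`), so `lStar` is a lower bound as well. Two lower bounds `max aStar
dStar` and `lStar` for the same rate give the factor 2.

Upper bound. Each user adds to its input a linear image `P i` of its key, the masks summing to zero,
and relays add up what they receive. Users in the total set get about `L` key symbols, the others
about `l i * L`. Security becomes surjectivity of finitely many linear maps of the source key
(`exists_linearCode_of_dims`). Generic coefficients achieve it by a counting argument in which a few
spare dimensions, bounded independently of `L`, replace a large field. Letting `L` grow removes this
overhead from the rate. -/

namespace WSHSA

/-! ### Shannon inequalities for finitely-valued variables. -/

section EntropyBasics

variable {Ω : Type*} {α β γ : Type*} [Fintype α] [Fintype β] [Fintype γ]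

/-- Merging outcomes loses entropy: each term is at most the sum, so its logarithm is too. -/
theorem sum_negMulLog_ge {ι : Type*} (s : Finset ι) (x : ι → ℝ) (hx : ∀ i ∈ s, 0 ≤ x i) :
    Real.negMulLog (∑ i ∈ s, x i) ≤ ∑ i ∈ s, Real.negMulLog (x i) := by
  simp only [Real.negMulLog, neg_mul, Finset.sum_neg_distrib, neg_le_neg_iff, Finset.sum_mul]
  refine Finset.sum_le_sum fun i hi => ?_
  rcases (hx i hi).eq_or_lt with h | h
  · simp [← h]
  · exact mul_le_mul_of_nonneg_left
      (Real.log_le_log h (Finset.single_le_sum hx hi)) h.le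

omit [Fintype α] in
theorem toReal_map_comp [DecidableEq α] (μ : PMF Ω) (g : Ω → β) (φ : β → α) (a : α) :
    ((μ.map fun ω => φ (g ω)) a).toReal
      = ∑ b with φ b = a, ((μ.map g) b).toReal := by
  have h : (μ.map fun ω => φ (g ω)) = (μ.map g).map φ := by
    rw [PMF.map_comp]; rfl
  rw [h, PMF.map_apply, tsum_fintype, Finset.sum_filter,
    ENNReal.toReal_sum (by intro b _; split_ifs; exacts [PMF.apply_ne_top _ _, ENNReal.zero_ne_top])]
  refine Finset.sum_congr rfl fun b _ => ?_
  by_cases hb : φ b = a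
  · simp [hb]
  · simp [hb, Ne.symm hb]

theorem log_card_nonneg (q : ℕ) : 0 ≤ Real.log q := Real.log_natCast_nonneg q

theorem entropy_comp_le (q : ℕ) (μ : PMF Ω) (g : Ω → β) (φ : β → α) :
    entropy q μ (fun ω => φ (g ω)) ≤ entropy q μ g := by
  classical
  unfold entropy
  simp only [← Finset.sum_div]
  refine div_le_div_of_nonneg_right ?_ (log_card_nonneg q)
  calc _ ≤ ∑ a, ∑ b with φ b = a, Real.negMulLog ((μ.map g) b).toReal := by
        refine Finset.sum_le_sum fun a _ => ?_
        rw [toReal_map_comp]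
        exact sum_negMulLog_ge _ _ fun _ _ => ENNReal.toReal_nonneg
    _ = _ := Finset.sum_fiberwise _ _ _

/-- A variable determined by another one has smaller entropy. -/
theorem entropy_le_of_factors (q : ℕ) (μ : PMF Ω) (f : Ω → α) (g : Ω → β)
    (h : ∀ ω ω', g ω = g ω' → f ω = f ω') : entropy q μ f ≤ entropy q μ g := by
  obtain ⟨ω₀, -⟩ := μ.support_nonempty
  have : Nonempty α := ⟨f ω₀⟩
  have hf : Function.FactorsThrough f g := fun a b hab => h a b hab
  obtain ⟨φ, hφ⟩ := (Function.factorsThrough_iff f).1 hf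
  have : f = fun ω => φ (g ω) := by rw [hφ]; rfl
  rw [this]
  exact entropy_comp_le q μ g φ

theorem entropy_congr (q : ℕ) (μ : PMF Ω) (f : Ω → α) (g : Ω → β)
    (h : ∀ ω ω', g ω = g ω' ↔ f ω = f ω') : entropy q μ f = entropy q μ g :=
  le_antisymm (entropy_le_of_factors q μ f g fun ω ω' => (h ω ω').1)
    (entropy_le_of_factors q μ g f fun ω ω' => (h ω ω').2)

/-- This is `log t ≤ t - 1` at `t = pa * pb / (p * pc)`, the summand in the proof that conditional
mutual information is nonnegative. -/
theorem submodular_pointwise {p pc pa pb : ℝ} (h0 : 0 ≤ p) (ha : p ≤ pa) (hb : p ≤ pb)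
    (hc : p ≤ pc) :
    p - pa * pb / pc ≤ p * (Real.log p + Real.log pc - Real.log pa - Real.log pb) := by
  rcases h0.eq_or_lt with h | h
  · subst h
    simp only [zero_sub, zero_mul, Left.neg_nonpos_iff]
    positivity
  · have hpa := h.trans_le ha
    have hpb := h.trans_le hb
    have hpc := h.trans_le hc
    have := Real.log_le_sub_one_of_pos (x := pa * pb / (p * pc)) (by positivity)
    rw [Real.log_div (by positivity) (by positivity), Real.log_mul hpa.ne' hpb.ne',
      Real.log_mul h.ne' hpc.ne'] at this
    have h2 := mul_le_mul_of_nonneg_left this h.le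
    have h3 : p * (pa * pb / (p * pc) - 1) = pa * pb / pc - p := by
      field_simp
    rw [h3] at h2
    linarith

/-- Submodularity of the entropy. -/
theorem entropy_submodular (q : ℕ) (μ : PMF Ω) (f : Ω → α) (g : Ω → β) (h : Ω → γ) :
    entropy q μ (fun ω => (f ω, g ω, h ω)) + entropy q μ h
      ≤ entropy q μ (fun ω => (f ω, h ω)) + entropy q μ (fun ω => (g ω, h ω)) := by
  classical
  unfold entropy
  simp only [← Finset.sum_div, ← add_div]
  refine div_le_div_of_nonneg_right ?_ (log_card_nonneg q)
  set P : α × β × γ → ℝ := fun x => ((μ.map fun ω => (f ω, g ω, h ω)) x).toReal with hP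
  have hP0 : ∀ x, 0 ≤ P x := fun x => ENNReal.toReal_nonneg
  have hc : ∀ c, ((μ.map h) c).toReal = ∑ a, ∑ b, P (a, b, c) := by
    intro c
    have := toReal_map_comp μ (fun ω => (f ω, g ω, h ω)) (fun x => x.2.2) c
    refine this.trans ?_
    rw [Finset.sum_filter, Fintype.sum_prod_type]
    refine Finset.sum_congr rfl fun a _ => ?_
    rw [Fintype.sum_prod_type]
    refine Finset.sum_congr rfl fun b _ => ?_
    simp [hP]
  have ha : ∀ a c, ((μ.map fun ω => (f ω, h ω)) (a, c)).toReal = ∑ b, P (a, b, c) := by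
    intro a c
    have := toReal_map_comp μ (fun ω => (f ω, g ω, h ω)) (fun x => (x.1, x.2.2)) (a, c)
    refine this.trans ?_
    rw [Finset.sum_filter, Fintype.sum_prod_type, Finset.sum_eq_single a]
    · rw [Fintype.sum_prod_type]
      refine Finset.sum_congr rfl fun b _ => ?_
      simp [hP]
    · intro a' _ ha'
      simp [ha']
    · simp
  have hb : ∀ b c, ((μ.map fun ω => (g ω, h ω)) (b, c)).toReal = ∑ a, P (a, b, c) := by
    intro b c
    have := toReal_map_comp μ (fun ω => (f ω, g ω, h ω)) (fun x => (x.2.1, x.2.2)) (b, c)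
    refine this.trans ?_
    rw [Finset.sum_filter, Fintype.sum_prod_type]
    refine Finset.sum_congr rfl fun a _ => ?_
    rw [Fintype.sum_prod_type, Finset.sum_eq_single b]
    · simp [hP]
    · intro b' _ hb'
      simp [hb']
    · simp
  set pc : γ → ℝ := fun c => ∑ a, ∑ b, P (a, b, c) with hpc
  set pa : α → γ → ℝ := fun a c => ∑ b, P (a, b, c) with hpa
  set pb : β → γ → ℝ := fun b c => ∑ a, P (a, b, c) with hpb
  have e0 : ∑ x, Real.negMulLog ((μ.map fun ω => (f ω, g ω, h ω)) x).toReal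
      = - ∑ c, ∑ a, ∑ b, P (a, b, c) * Real.log (P (a, b, c)) := by
    have hcomm : (∑ c, ∑ a, ∑ b, P (a, b, c) * Real.log (P (a, b, c)))
        = ∑ a, ∑ b, ∑ c, P (a, b, c) * Real.log (P (a, b, c)) := by
      rw [Finset.sum_comm]
      exact Finset.sum_congr rfl fun a _ => Finset.sum_comm
    rw [hcomm]
    simp only [Fintype.sum_prod_type, Real.negMulLog, neg_mul, Finset.sum_neg_distrib, hP]
  have e1 : ∑ c, Real.negMulLog ((μ.map h) c).toReal
      = - ∑ c, ∑ a, ∑ b, P (a, b, c) * Real.log (pc c) := by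
    rw [← Finset.sum_neg_distrib]
    refine Finset.sum_congr rfl fun c _ => ?_
    simp only [hc, Real.negMulLog, ← Finset.sum_mul, neg_mul, hpc]
  have e2 : ∑ x, Real.negMulLog ((μ.map fun ω => (f ω, h ω)) x).toReal
      = - ∑ c, ∑ a, ∑ b, P (a, b, c) * Real.log (pa a c) := by
    rw [Fintype.sum_prod_type, Finset.sum_comm, ← Finset.sum_neg_distrib]
    refine Finset.sum_congr rfl fun c _ => ?_
    rw [← Finset.sum_neg_distrib]
    refine Finset.sum_congr rfl fun a _ => ?_
    simp only [ha, Real.negMulLog, ← Finset.sum_mul, neg_mul, hpa]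
  have e3 : ∑ x, Real.negMulLog ((μ.map fun ω => (g ω, h ω)) x).toReal
      = - ∑ c, ∑ a, ∑ b, P (a, b, c) * Real.log (pb b c) := by
    rw [Fintype.sum_prod_type, Finset.sum_comm, ← Finset.sum_neg_distrib]
    refine Finset.sum_congr rfl fun c _ => ?_
    rw [Finset.sum_comm, ← Finset.sum_neg_distrib]
    refine Finset.sum_congr rfl fun b _ => ?_
    simp only [hb, Real.negMulLog, ← Finset.sum_mul, neg_mul, hpb]
  rw [e0, e1, e2, e3]
  have key : ∀ c a b, P (a, b, c) - pa a c * pb b c / pc c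
      ≤ P (a, b, c) * (Real.log (P (a, b, c)) + Real.log (pc c)
        - Real.log (pa a c) - Real.log (pb b c)) := by
    intro c a b
    have h1 : P (a, b, c) ≤ pa a c :=
      Finset.single_le_sum (f := fun b => P (a, b, c)) (fun _ _ => hP0 _) (Finset.mem_univ b)
    have h2 : P (a, b, c) ≤ pb b c :=
      Finset.single_le_sum (f := fun a => P (a, b, c)) (fun _ _ => hP0 _) (Finset.mem_univ a)
    have h3 : pa a c ≤ pc c :=
      Finset.single_le_sum (f := fun a => pa a c)
        (fun _ _ => Finset.sum_nonneg fun _ _ => hP0 _) (Finset.mem_univ a)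
    exact submodular_pointwise (hP0 _) h1 h2 (h1.trans h3)
  -- Summing `pa * pb / pc` over `a` and `b` gives back `pc`, so the linear lower bounds cancel in
  -- total. Where `pc c = 0` the convention `x / 0 = 0` gives the right value.
  have tot : ∑ c, ∑ a, ∑ b, (P (a, b, c) - pa a c * pb b c / pc c) = 0 := by
    refine Finset.sum_eq_zero fun c _ => ?_
    have h1 : ∑ a, pa a c = pc c := rfl
    have h2 : ∑ b, pb b c = pc c := Finset.sum_comm
    simp only [Finset.sum_sub_distrib, ← Finset.sum_div, ← Finset.mul_sum, ← Finset.sum_mul, h1, h2]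
    rw [mul_self_div_self]
    exact sub_self _
  have := Finset.sum_le_sum (s := Finset.univ) fun c _ =>
    Finset.sum_le_sum (s := Finset.univ) fun a _ =>
    Finset.sum_le_sum (s := Finset.univ) fun b _ => key c a b
  rw [tot] at this
  simp only [mul_sub, mul_add, Finset.sum_sub_distrib, Finset.sum_add_distrib] at this
  linarith

theorem sum_toReal_map (μ : PMF Ω) (f : Ω → α) : ∑ a, ((μ.map f) a).toReal = 1 := by
  rw [← ENNReal.toReal_sum (fun _ _ => PMF.apply_ne_top _ _), ← tsum_fintype (L := .unconditional _),
    PMF.tsum_coe]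
  simp

theorem entropy_le_log_card [Nonempty α] (q : ℕ) (μ : PMF Ω) (f : Ω → α) :
    entropy q μ f ≤ Real.log (Fintype.card α) / Real.log q := by
  unfold entropy
  simp only [← Finset.sum_div]
  refine div_le_div_of_nonneg_right ?_ (log_card_nonneg q)
  have hn : (0 : ℝ) < Fintype.card α := by exact_mod_cast Fintype.card_pos
  have key : ∀ a, Real.negMulLog ((μ.map f) a).toReal
      ≤ ((μ.map f) a).toReal * Real.log (Fintype.card α) +
        ((Fintype.card α : ℝ)⁻¹ - ((μ.map f) a).toReal) := by
    intro a
    set x := ((μ.map f) a).toReal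
    have hx : 0 ≤ x := ENNReal.toReal_nonneg
    rcases hx.eq_or_lt with h | h
    · rw [← h]; simp
    · have h1 := Real.log_le_sub_one_of_pos (x := (x * Fintype.card α)⁻¹) (by positivity)
      rw [Real.log_inv, Real.log_mul h.ne' hn.ne'] at h1
      have h2 := mul_le_mul_of_nonneg_left h1 h.le
      have h3 : x * ((x * Fintype.card α)⁻¹ - 1) = (Fintype.card α : ℝ)⁻¹ - x := by
        field_simp
      rw [h3] at h2
      rw [Real.negMulLog]
      linarith
  refine (Finset.sum_le_sum fun a _ => key a).trans ?_
  rw [Finset.sum_add_distrib, ← Finset.sum_mul, Finset.sum_sub_distrib, sum_toReal_map]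
  simp [hn.ne']

theorem entropy_of_uniform [Nonempty α] (q : ℕ) (μ : PMF Ω) (f : Ω → α)
    (hf : μ.map f = PMF.uniformOfFintype α) :
    entropy q μ f = Real.log (Fintype.card α) / Real.log q := by
  unfold entropy
  have hn : (Fintype.card α : ℝ) ≠ 0 := by exact_mod_cast Fintype.card_ne_zero
  simp [hf, PMF.uniformOfFintype_apply, Real.negMulLog]
  field_simp

theorem log_card_fun_div {F : Type*} [Field F] [Fintype F] (L : ℕ) :
    Real.log (Fintype.card (Fin L → F)) / Real.log (Fintype.card F) = L := by
  have : 0 < Real.log (Fintype.card F) :=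
    Real.log_pos (by exact_mod_cast Fintype.one_lt_card)
  simp [this.ne']

end EntropyBasics

/-! ### The entropy function of a scheme, abstracted to its inequalities. -/

/-- The names of the random variables of a scheme. -/
inductive Var {U : ℕ} (V : Fin U → ℕ) : Type
  | w (i : User V)
  | z (i : User V)
  | x (i : User V)
  | y (u : Fin U)
  | sum
  deriving DecidableEq

namespace Var

variable {U : ℕ} {V : Fin U → ℕ}

def ws (A : Finset (User V)) : Finset (Var V) := A.image w
def zs (A : Finset (User V)) : Finset (Var V) := A.image z
def xs (A : Finset (User V)) : Finset (Var V) := A.image x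
def ys (A : Finset (Fin U)) : Finset (Var V) := A.image y
def total : Finset (Var V) := {sum}

section
variable {A : Finset (User V)} {R : Finset (Fin U)} {i : User V} {u : Fin U}
@[simp, grind =] theorem w_mem_ws : w i ∈ ws A ↔ i ∈ A := by simp [ws]
@[simp, grind =] theorem z_mem_ws : z i ∈ ws A ↔ False := by simp [ws]
@[simp, grind =] theorem x_mem_ws : x i ∈ ws A ↔ False := by simp [ws]
@[simp, grind =] theorem y_mem_ws : y u ∈ ws A ↔ False := by simp [ws]
@[simp, grind =] theorem sum_mem_ws : sum ∈ ws A ↔ False := by simp [ws]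
@[simp, grind =] theorem w_mem_zs : w i ∈ zs A ↔ False := by simp [zs]
@[simp, grind =] theorem z_mem_zs : z i ∈ zs A ↔ i ∈ A := by simp [zs]
@[simp, grind =] theorem x_mem_zs : x i ∈ zs A ↔ False := by simp [zs]
@[simp, grind =] theorem y_mem_zs : y u ∈ zs A ↔ False := by simp [zs]
@[simp, grind =] theorem sum_mem_zs : sum ∈ zs A ↔ False := by simp [zs]
@[simp, grind =] theorem w_mem_xs : w i ∈ xs A ↔ False := by simp [xs]
@[simp, grind =] theorem z_mem_xs : z i ∈ xs A ↔ False := by simp [xs]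
@[simp, grind =] theorem x_mem_xs : x i ∈ xs A ↔ i ∈ A := by simp [xs]
@[simp, grind =] theorem y_mem_xs : y u ∈ xs A ↔ False := by simp [xs]
@[simp, grind =] theorem sum_mem_xs : sum ∈ xs A ↔ False := by simp [xs]
@[simp, grind =] theorem w_mem_ys : w i ∈ (ys R : Finset (Var V)) ↔ False := by simp [ys]
@[simp, grind =] theorem z_mem_ys : z i ∈ (ys R : Finset (Var V)) ↔ False := by simp [ys]
@[simp, grind =] theorem x_mem_ys : x i ∈ (ys R : Finset (Var V)) ↔ False := by simp [ys]
@[simp, grind =] theorem y_mem_ys : y u ∈ (ys R : Finset (Var V)) ↔ u ∈ R := by simp [ys]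
@[simp, grind =] theorem sum_mem_ys : sum ∈ (ys R : Finset (Var V)) ↔ False := by simp [ys]
@[simp, grind =] theorem w_mem_total : w i ∈ (total : Finset (Var V)) ↔ False := by simp [total]
@[simp, grind =] theorem z_mem_total : z i ∈ (total : Finset (Var V)) ↔ False := by simp [total]
@[simp, grind =] theorem x_mem_total : x i ∈ (total : Finset (Var V)) ↔ False := by simp [total]
@[simp, grind =] theorem y_mem_total : y u ∈ (total : Finset (Var V)) ↔ False := by simp [total]
@[simp, grind =] theorem sum_mem_total : sum ∈ (total : Finset (Var V)) ↔ True := by simp [total]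
end

theorem subset_iff {A B : Finset (Var V)} : A ⊆ B ↔
    (∀ i, w i ∈ A → w i ∈ B) ∧ (∀ i, z i ∈ A → z i ∈ B) ∧ (∀ i, x i ∈ A → x i ∈ B) ∧
    (∀ u, y u ∈ A → y u ∈ B) ∧ (sum ∈ A → sum ∈ B) := by
  refine ⟨fun h => ⟨fun _ => @h _, fun _ => @h _, fun _ => @h _, fun _ => @h _, @h _⟩, ?_⟩
  rintro ⟨h1, h2, h3, h4, h5⟩ (i | i | i | u | _)
  exacts [h1 i, h2 i, h3 i, h4 u, h5]

end Var

open Var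

/-- The entropic properties of a scheme: `h` is the joint entropy function of the variables. -/
structure SchemeEntropy {U : ℕ} (V : Fin U → ℕ) (𝒮 𝒯 : Finset (Finset (User V)))
    (h : Finset (Var V) → ℝ) (L R : ℝ) : Prop where
  L_pos : 0 < L
  empty : h ∅ = 0
  mono : ∀ A B, A ⊆ B → h A ≤ h B
  submod : ∀ A B, h (A ∪ B) + h (A ∩ B) ≤ h A + h B
  input_le : ∀ i, h (ws {i}) ≤ L
  total_le : h total ≤ L
  indep : Fintype.card (User V) * L + h (zs Finset.univ) ≤ h (ws Finset.univ ∪ zs Finset.univ)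
  keys_le : h (zs Finset.univ) ≤ R * L
  msgX : ∀ i, h (ws {i} ∪ zs {i} ∪ xs {i}) ≤ h (ws {i} ∪ zs {i})
  msgY : ∀ u, h (xs (cluster V u) ∪ ys {u}) ≤ h (xs (cluster V u))
  recovery : h (ys Finset.univ ∪ total) ≤ h (ys Finset.univ)
  last_input : ∀ i, h (total ∪ ws (Finset.univ.erase i) ∪ ws {i})
    ≤ h (total ∪ ws (Finset.univ.erase i))
  server_security : ∀ S ∈ 𝒮, ∀ T ∈ 𝒯,
    h (ys Finset.univ ∪ total ∪ ws T ∪ zs T) + h (ws S ∪ total ∪ ws T ∪ zs T) ≤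
    h (ys Finset.univ ∪ ws S ∪ total ∪ ws T ∪ zs T) + h (total ∪ ws T ∪ zs T)
  relay_security : ∀ u, ∀ S ∈ 𝒮, ∀ T ∈ 𝒯,
    h (xs (cluster V u) ∪ ws T ∪ zs T) + h (ws S ∪ ws T ∪ zs T) ≤
    h (xs (cluster V u) ∪ ws S ∪ ws T ∪ zs T) + h (ws T ∪ zs T)

/-! ### Determination and secrecy through submodularity. -/

namespace SchemeEntropy

variable {U : ℕ} {V : Fin U → ℕ} {𝒮 𝒯 : Finset (Finset (User V))}
  {h : Finset (Var V) → ℝ} {L R : ℝ} (E : SchemeEntropy V 𝒮 𝒯 h L R)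

/-- `B` determines `A`. -/
def Det (h : Finset (Var V) → ℝ) (B A : Finset (Var V)) : Prop := h (B ∪ A) ≤ h B

include E

/-- Submodularity combined with monotonicity, so that each application only needs inclusions to be
checked. -/
theorem sm {A B P Q : Finset (Var V)} (hP : P ⊆ A ∪ B) (hA : Q ⊆ A) (hB : Q ⊆ B) :
    h P + h Q ≤ h A + h B :=
  (add_le_add (E.mono _ _ hP) (E.mono _ _ (Finset.subset_inter hA hB))).trans (E.submod A B)

theorem det_mono {A B B' : Finset (Var V)} (hd : Det h B A) (hB : B ⊆ B') : Det h B' A := by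
  have := E.sm (P := B' ∪ A) (Q := B) (A := B') (B := B ∪ A) (by grind) hB (by grind)
  unfold Det at *
  linarith

theorem det_subset {A B : Finset (Var V)} (hA : A ⊆ B) : Det h B A :=
  E.mono _ _ (Finset.union_subset subset_rfl hA)

theorem det_union {A A' B : Finset (Var V)} (hd : Det h B A) (hd' : Det h B A') :
    Det h B (A ∪ A') := by
  have := E.sm (P := B ∪ (A ∪ A')) (Q := B) (A := B ∪ A) (B := B ∪ A') (by grind) (by grind)
    (by grind)
  unfold Det at *
  linarith

theorem det_trans {A A' B : Finset (Var V)} (hd : Det h B A) (hd' : Det h A A') :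
    Det h B A' := by
  have := E.det_mono hd' (B' := B ∪ A) (by grind)
  have h2 := E.mono (B ∪ A') (B ∪ A ∪ A') (by grind)
  unfold Det at *
  linarith

theorem det_of_subset {A A' B : Finset (Var V)} (hd : Det h B A) (hA : A' ⊆ A) :
    Det h B A' := E.det_trans hd (E.det_subset hA)

theorem det_of_forall {A B : Finset (Var V)} (hd : ∀ v ∈ A, Det h B {v}) : Det h B A := by
  induction A using Finset.induction_on with
  | empty => exact E.det_subset (by simp)
  | insert a s _ ih =>
    rw [Finset.insert_eq]
    exact E.det_union (hd a (by simp)) (ih fun v hv => hd v (by simp [hv]))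

theorem det_xs (D : Finset (User V)) : Det h (ws D ∪ zs D) (xs D) := by
  refine E.det_of_forall fun v hv => ?_
  obtain ⟨i, hi, rfl⟩ := Finset.mem_image.1 hv
  have : Det h (ws {i} ∪ zs {i}) {x i} := E.msgX i
  refine E.det_mono this ?_
  rw [Var.subset_iff]
  grind

theorem det_ys (Us : Finset (Fin U)) (D : Finset (User V)) (hD : ∀ u ∈ Us, cluster V u ⊆ D) :
    Det h (xs D) (ys Us) := by
  refine E.det_of_forall fun v hv => ?_
  obtain ⟨u, hu, rfl⟩ := Finset.mem_image.1 hv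
  have : Det h (xs (cluster V u)) {y u} := E.msgY u
  refine E.det_mono this ?_
  have := hD u hu
  rw [Var.subset_iff]
  grind

theorem det_total : Det h (ys Finset.univ) total := E.recovery

theorem ws_union_le (A : Finset (User V)) (B : Finset (Var V)) :
    h (B ∪ ws A) ≤ h B + A.card * L := by
  induction A using Finset.induction_on with
  | empty => simp [ws]
  | insert a s ha ih =>
    have h1 := E.sm (A := B ∪ ws s) (B := ws {a}) (P := B ∪ ws (insert a s)) (Q := ∅)
      (by rw [Var.subset_iff]; grind [Finset.mem_compl]) (by simp) (by simp)
    have h2 := E.input_le a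
    have h3 := E.empty
    rw [Finset.card_insert_of_notMem ha]
    push_cast
    linarith

/-- Independence of the full family descends to subfamilies. Dropping an input loses at most `L`,
and by submodularity dropping keys costs no more in the presence of the inputs than in their
absence. -/
theorem ws_zs (A B : Finset (User V)) : h (ws A ∪ zs B) = A.card * L + h (zs B) := by
  apply le_antisymm
  · have := E.ws_union_le A (zs B)
    rw [Finset.union_comm]
    linarith
  · have h1 := E.sm (A := ws A ∪ zs B) (B := zs Finset.univ) (Q := zs B)
      (P := ws A ∪ zs Finset.univ) (by rw [Var.subset_iff]; grind [Finset.mem_compl]) (by rw [Var.subset_iff]; grind [Finset.mem_compl])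
      (by rw [Var.subset_iff]; grind [Finset.mem_compl])
    have h2 := E.ws_union_le Aᶜ (ws A ∪ zs Finset.univ)
    have h3 := E.mono (ws Finset.univ ∪ zs Finset.univ) (ws A ∪ zs Finset.univ ∪ ws Aᶜ)
      (by rw [Var.subset_iff]; grind [Finset.mem_compl])
    have h4 := E.indep
    have h5 : (Fintype.card (User V) : ℝ) = A.card + Aᶜ.card := by
      exact_mod_cast (Finset.card_add_card_compl A).symm
    rw [h5] at h4
    linarith

/-- The total together with all inputs but one determines that input. -/
theorem det_last_input {i : User V} {B : Finset (Var V)} (ht : Det h B total)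
    (hB : ws (Finset.univ.erase i) ⊆ B) : Det h B (ws {i}) :=
  E.det_trans (E.det_union ht (E.det_subset hB)) (E.last_input i)

/-- If `M` is a function of the inputs and keys of `D`, and the total is recovered from `M` and the
data of the other users, then `M` determines any input of `D` given the keys and other inputs of
`D`. -/
theorem det_input {M : Finset (Var V)} {D : Finset (User V)} {i : User V} (hi : i ∈ D)
    (hM : Det h (ws D ∪ zs D) M) (hs : Det h (M ∪ ws Dᶜ ∪ zs Dᶜ) total) :
    Det h (M ∪ ws (D.erase i) ∪ zs D) (ws {i}) := by
  set Q := M ∪ ws (D.erase i) ∪ zs D with hQ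
  set R' := ws Dᶜ ∪ zs Dᶜ with hR
  have h1 : Det h (Q ∪ R') (ws {i}) := by
    refine E.det_last_input (E.det_mono hs ?_) ?_
    · grind
    · rw [Var.subset_iff]; grind [Finset.mem_compl]
  -- `Q` and the data outside `D` determine all inputs and keys, while the outside data add at most
  -- `Dᶜ.card * L + h (zs univ) - h (zs D)`. Hence `Q` already has the full entropy `D.card * L + h
  -- (zs D)` of the data of `D`, which leaves nothing undetermined.
  have h2 := E.sm (A := Q) (B := ws Dᶜ ∪ zs Finset.univ) (P := Q ∪ R') (Q := zs D)
    (by rw [Var.subset_iff]; grind [Finset.mem_compl]) (by grind) (by rw [Var.subset_iff]; grind [Finset.mem_compl])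
  have h3 := E.mono (ws Finset.univ ∪ zs Finset.univ) (Q ∪ R' ∪ ws {i})
    (by rw [Var.subset_iff]; grind [Finset.mem_compl])
  have h4 := E.mono (Q ∪ ws {i}) (ws D ∪ zs D ∪ M) (by rw [Var.subset_iff]; grind [Finset.mem_compl])
  have h5 := E.ws_zs Dᶜ Finset.univ
  have h6 := E.ws_zs D D
  have h7 := E.ws_zs Finset.univ Finset.univ
  have h8 : ((Finset.univ : Finset (User V)).card : ℝ) = D.card + Dᶜ.card := by
    exact_mod_cast (Finset.card_add_card_compl D).symm
  rw [h8] at h7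
  unfold Det at *
  linarith

/-- `M` reveals nothing about the inputs of `S` to the users of `T`. -/
def Secret (h : Finset (Var V) → ℝ) (L : ℝ) (M : Finset (Var V)) (S T : Finset (User V)) : Prop :=
  S.card * L + h (M ∪ ws T ∪ zs T) ≤ h (M ∪ ws T ∪ zs T ∪ ws S)

/-- Fix `i ∈ S` and give the colluders `M`, every input except that of `i`, and their own keys: the
input of `i` is still uniform to them. The keys outside `S ∪ T` would complete the total and reveal
it, so these keys have at least `L` units of entropy given those of `T`. -/
theorem le_keys_compl {M : Finset (Var V)} {S T : Finset (User V)}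
    (hS : S.Nonempty) (hM : Det h (ws S ∪ zs S ∪ ws T ∪ zs T) M) (hsec : Secret h L M S T)
    (hs : Det h (M ∪ ws (S ∪ T)ᶜ ∪ zs (S ∪ T)ᶜ ∪ ws T ∪ zs T) total) :
    L + h (zs T) ≤ h (zs T ∪ zs (S ∪ T)ᶜ) := by
  obtain ⟨i, hi⟩ := hS
  set e := (S ∪ T)ᶜ with he
  set B := M ∪ ws T ∪ zs T with hB
  set Q := B ∪ ws (S.erase i) ∪ ws e with hQ
  -- Since `M` is a function of the data of `S ∪ T`, the inputs of `e` remain uniform given `B` and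
  -- the inputs of `S`.
  have h1 := E.sm (A := B ∪ ws S ∪ ws e) (B := ws (S ∪ T) ∪ zs (S ∪ T) ∪ M) (Q := B ∪ ws S)
    (P := ws Finset.univ ∪ zs (S ∪ T)) (by rw [Var.subset_iff]; grind [Finset.mem_compl]) (by grind)
    (by rw [Var.subset_iff]; grind [Finset.mem_compl])
  have hM' : Det h (ws (S ∪ T) ∪ zs (S ∪ T)) M :=
    E.det_mono hM (by rw [Var.subset_iff]; grind [Finset.mem_compl])
  have h2 := E.ws_zs Finset.univ (S ∪ T)
  have h3 := E.ws_zs (S ∪ T) (S ∪ T)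
  have h4 : ((Finset.univ : Finset (User V)).card : ℝ) = (S ∪ T).card + e.card := by
    exact_mod_cast (Finset.card_add_card_compl _).symm
  rw [h4] at h2
  have h5 := E.ws_union_le (S.erase i) B
  have h6 := E.ws_union_le e (B ∪ ws (S.erase i))
  have h7 : (S.card : ℝ) = (S.erase i).card + 1 := by
    exact_mod_cast (Finset.card_erase_add_one hi).symm
  have h8 : Det h (Q ∪ zs e) (ws {i}) := by
    refine E.det_last_input (E.det_mono hs ?_) ?_
    · grind
    · rw [Var.subset_iff]; grind [Finset.mem_compl]
  have h9 := E.mono (B ∪ ws S ∪ ws e) (Q ∪ zs e ∪ ws {i}) (by rw [Var.subset_iff]; grind [Finset.mem_compl])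
  have h10 := E.sm (A := Q) (B := zs T ∪ zs e) (P := Q ∪ zs e) (Q := zs T) (by grind)
    (by grind) (by grind)
  unfold Det Secret at *
  rw [h7] at hsec
  linarith

/-- Without the keys of `S`, the inputs of `Rp` are uniform even given `M` and the other inputs of
`S`. With these keys they are determined, so the keys must make up the whole difference. -/
theorem le_keys {M : Finset (Var V)} {S T Rp : Finset (User V)} (hR : Rp ⊆ S)
    (hsec : Secret h L M S T)
    (hd : Det h (M ∪ ws (S \ Rp) ∪ zs S ∪ ws T ∪ zs T) (ws Rp)) :
    Rp.card * L + h (zs T) ≤ h (zs T ∪ zs S) := by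
  set B := M ∪ ws T ∪ zs T with hB
  set Q := B ∪ ws (S \ Rp) with hQ
  have h1 := E.ws_union_le (S \ Rp) B
  have h2 : (S.card : ℝ) = (S \ Rp).card + Rp.card := by
    exact_mod_cast (Finset.card_sdiff_add_card_eq_card hR).symm
  have h3 : Det h (Q ∪ zs S) (ws Rp) := E.det_mono hd (by grind)
  have h4 := E.mono (B ∪ ws S) (Q ∪ zs S ∪ ws Rp) (by rw [Var.subset_iff]; grind [Finset.mem_compl])
  have h5 := E.sm (A := Q) (B := zs T ∪ zs S) (P := Q ∪ zs S) (Q := zs T) (by grind)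
    (by grind) (by grind)
  unfold Det Secret at *
  rw [h2] at hsec
  linarith

end SchemeEntropy

/-! ### Clusters, security relays and covers. -/

section Covers

variable {U : ℕ} {V : Fin U → ℕ}

@[simp] theorem mem_cluster {u : Fin U} {i : User V} : i ∈ cluster V u ↔ i.1 = u := by
  simp [cluster]

@[simp] theorem mem_clusters {R : Finset (Fin U)} {i : User V} : i ∈ clusters V R ↔ i.1 ∈ R := by
  simp [clusters]

theorem card_cluster (u : Fin U) : (cluster V u).card = V u := by
  have : cluster V u = Finset.univ.map ⟨Sigma.mk u, sigma_mk_injective⟩ := by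
    ext ⟨a, b⟩
    simp only [mem_cluster, Finset.mem_map, Finset.mem_univ, true_and,
      Function.Embedding.coeFn_mk]
    constructor
    · rintro rfl
      exact ⟨b, rfl⟩
    · rintro ⟨c, hc⟩
      exact (congrArg Sigma.fst hc).symm
  rw [this]
  simp

theorem card_user : Fintype.card (User V) = numUsers V := by
  simp [numUsers, Fintype.card_sigma]

theorem card_univ_user : (Finset.univ : Finset (User V)).card = numUsers V := by
  rw [Finset.card_univ, card_user]

theorem mem_securityRelays {S T : Finset (User V)} {u : Fin U} :
    u ∈ securityRelays V S T ↔ (S ∩ cluster V u).Nonempty ∧ cluster V u ⊆ S ∪ T := by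
  simp only [securityRelays, Finset.mem_filter, Finset.mem_univ, true_and, Finset.card_ne_zero]
  refine and_congr_right fun _ => ?_
  rw [← card_cluster (V := V) u]
  constructor
  · intro h
    have := Finset.eq_of_subset_of_card_le Finset.inter_subset_right h.ge
    rw [← this]
    exact Finset.inter_subset_left
  · intro h
    rw [Finset.inter_eq_right.2 h]

/-- The users of the security relays outside the collusion set. -/
theorem serverCover_sdiff_subset (S T : Finset (User V)) :
    serverCover V S T \ T ⊆ S := by
  intro i hi
  simp only [serverCover, Finset.mem_sdiff, Finset.mem_union, mem_clusters,
    mem_securityRelays] at hi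
  obtain ⟨⟨⟨-, h⟩⟩ | h, hT⟩ := hi
  · have := h (mem_cluster.2 rfl : i ∈ cluster V i.1)
    grind
  · exact absurd h hT

theorem subset_serverCover (S T : Finset (User V)) : T ⊆ serverCover V S T :=
  Finset.subset_union_right

theorem subset_relayCover (u : Fin U) (S T : Finset (User V)) : T ⊆ relayCover V u S T :=
  Finset.subset_union_right

end Covers

open Var

/-! ### The converse: lower bounds on the key entropy. -/

namespace SchemeEntropy

variable {U : ℕ} {V : Fin U → ℕ} {𝒮 𝒯 : Finset (Finset (User V))}
  {h : Finset (Var V) → ℝ} {L R : ℝ} (E : SchemeEntropy V 𝒮 𝒯 h L R)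

include E

theorem relay_secret {u : Fin U} {S T : Finset (User V)} (hS : S ∈ 𝒮) (hT : T ∈ 𝒯)
    (hSu : S ⊆ cluster V u) (hST : Disjoint S T) : Secret h L (xs S) S T := by
  have h1 := E.relay_security u S hS T hT
  have h2 := E.sm (A := xs S ∪ ws T ∪ zs T ∪ ws S) (B := xs (cluster V u) ∪ ws T ∪ zs T)
    (P := xs (cluster V u) ∪ ws S ∪ ws T ∪ zs T) (Q := xs S ∪ ws T ∪ zs T)
    (by grind) (by grind) (by rw [Var.subset_iff]; grind)
  have h3 := E.ws_zs (S ∪ T) T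
  have h4 := E.ws_zs T T
  have h5 := E.mono (ws (S ∪ T) ∪ zs T) (ws S ∪ ws T ∪ zs T) (by rw [Var.subset_iff]; grind)
  rw [Finset.card_union_of_disjoint hST] at h3
  push_cast at h3
  unfold Secret
  linarith

/-- The server also sees the total, but the input of a user `j` outside `S ∪ T` masks it: given the
total and the data of `T`, the inputs of `S` are still uniform. This is why `S ∪ T` must not be
everything. -/
theorem server_secret {S T : Finset (User V)} (hS : S ∈ 𝒮) (hT : T ∈ 𝒯) (hST : Disjoint S T)
    (hne : S ∪ T ≠ Finset.univ) (Us : Finset (Fin U)) : Secret h L (ys Us) S T := by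
  obtain ⟨j, hj⟩ : ∃ j, j ∉ S ∪ T := by
    by_contra! hcon
    exact hne (Finset.eq_univ_iff_forall.2 hcon)
  have h1 := E.server_security S hS T hT
  have h2 := E.sm (A := ys Us ∪ ws T ∪ zs T ∪ ws S) (B := ys Finset.univ ∪ total ∪ ws T ∪ zs T)
    (P := ys Finset.univ ∪ ws S ∪ total ∪ ws T ∪ zs T) (Q := ys Us ∪ ws T ∪ zs T)
    (by grind) (by grind) (by rw [Var.subset_iff]; grind)
  have hd := Finset.disjoint_left.1 hST
  set J := (Finset.univ \ S).erase j with hJ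
  have h3 := E.sm (A := ws S ∪ total ∪ ws T ∪ zs T) (B := total ∪ ws J ∪ zs T)
    (P := total ∪ ws (Finset.univ.erase j) ∪ zs T) (Q := total ∪ ws T ∪ zs T)
    (by rw [Var.subset_iff]; grind) (by grind) (by rw [Var.subset_iff]; grind)
  have h4 : Det h (total ∪ ws (Finset.univ.erase j) ∪ zs T) (ws {j}) :=
    E.det_last_input (E.det_subset (by grind)) (by grind)
  have h5 := E.mono (ws Finset.univ ∪ zs T) (total ∪ ws (Finset.univ.erase j) ∪ zs T ∪ ws {j})
    (by rw [Var.subset_iff]; grind)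
  have h6 := E.ws_zs Finset.univ T
  have h7 := E.ws_union_le J (total ∪ zs T)
  have h8 := E.sm (A := total) (B := zs T) (P := total ∪ zs T) (Q := ∅) (by grind) (by simp)
    (by simp)
  have h9 := E.total_le
  have h10 := E.empty
  have h11 : ((Finset.univ : Finset (User V)).card : ℝ) = S.card + J.card + 1 := by
    have e1 : J.card + 1 = (Finset.univ \ S).card :=
      Finset.card_erase_add_one (by simp; grind)
    have e2 := Finset.card_sdiff_add_card_eq_card (Finset.subset_univ S)
    exact_mod_cast (by omega : (Finset.univ : Finset (User V)).card = S.card + J.card + 1)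
  have h12 := E.mono (total ∪ ws J ∪ zs T) (total ∪ zs T ∪ ws J) (by grind)
  rw [h11] at h6
  unfold Secret Det at *
  linarith

/-- Apply `le_keys_compl` to the messages of `S`: the data outside `S` yield the other messages,
hence the relay messages and the total. -/
theorem relay_edge {u : Fin U} {S T : Finset (User V)} (hS : S ∈ 𝒮) (hT : T ∈ 𝒯)
    (hSu : S ⊆ cluster V u) (hST : Disjoint S T) (hne : S.Nonempty) :
    L + h (zs T) ≤ h (zs T ∪ zs (S ∪ T)ᶜ) := by
  refine E.le_keys_compl hne ?_ (E.relay_secret hS hT hSu hST) ?_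
  · exact E.det_mono (E.det_xs S) (by grind)
  · set B := xs S ∪ ws (S ∪ T)ᶜ ∪ zs (S ∪ T)ᶜ ∪ ws T ∪ zs T
    have h1 : Det h B (xs Sᶜ) :=
      E.det_mono (E.det_xs Sᶜ) (by rw [Var.subset_iff]; grind [Finset.mem_compl])
    have h2 : Det h B (xs Finset.univ) := by
      refine E.det_of_subset (E.det_union h1 (E.det_subset (A := xs S) (by grind))) ?_
      rw [Var.subset_iff]; grind [Finset.mem_compl]
    exact E.det_trans (E.det_trans h2 (E.det_ys Finset.univ _ (by simp))) E.det_total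

/-- Given its key, a single user's message determines its input, because the others' data complete
the recovery. Thus `le_keys` applies with all of `S` revealed. -/
theorem relay_keys {u : Fin U} {S T : Finset (User V)} (hS : S ∈ 𝒮) (hT : T ∈ 𝒯)
    (hSu : S ⊆ cluster V u) (hST : Disjoint S T) :
    S.card * L + h (zs T) ≤ h (zs T ∪ zs S) := by
  refine E.le_keys subset_rfl (E.relay_secret hS hT hSu hST) ?_
  refine E.det_of_forall fun v hv => ?_
  obtain ⟨i, hi, rfl⟩ := Finset.mem_image.1 hv
  have h1 := E.det_input (M := xs {i}) (D := {i}) (i := i) (by simp) (E.det_xs {i}) ?_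
  · refine E.det_mono h1 ?_
    rw [Var.subset_iff]; grind
  · set B := xs {i} ∪ ws {i}ᶜ ∪ zs {i}ᶜ
    have h1 : Det h B (xs {i}ᶜ) :=
      E.det_mono (E.det_xs {i}ᶜ) (by rw [Var.subset_iff]; grind [Finset.mem_compl])
    have h2 : Det h B (xs Finset.univ) := by
      refine E.det_of_subset (E.det_union h1 (E.det_subset (A := xs {i}) (by grind))) ?_
      rw [Var.subset_iff]; grind [Finset.mem_compl]
    exact E.det_trans (E.det_trans h2 (E.det_ys Finset.univ _ (by simp))) E.det_total

/-- Here the hidden message is that of the relays in `Us`. A relay outside `Us` has no user in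
`clusters V Us`, so its message is computable from the data of `(S ∪ T)ᶜ ∪ T`. -/
theorem server_edge {Us : Finset (Fin U)} {S T : Finset (User V)} (hS : S ∈ 𝒮) (hT : T ∈ 𝒯)
    (hU : S ∪ T = clusters V Us ∪ T) (hST : Disjoint S T) (hne : S.Nonempty)
    (huniv : S ∪ T ≠ Finset.univ) :
    L + h (zs T) ≤ h (zs T ∪ zs (S ∪ T)ᶜ) := by
  have hcl : ∀ u ∈ Us, cluster V u ⊆ S ∪ T := by
    intro u hu i hi
    rw [hU]
    exact Finset.mem_union_left _ (mem_clusters.2 (by rwa [mem_cluster.1 hi]))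
  refine E.le_keys_compl hne ?_ (E.server_secret hS hT hST huniv Us) ?_
  · refine E.det_trans (A := xs (S ∪ T)) ?_ (E.det_ys _ _ hcl)
    exact E.det_mono (E.det_xs (S ∪ T)) (by rw [Var.subset_iff]; grind)
  · set B := ys Us ∪ ws (S ∪ T)ᶜ ∪ zs (S ∪ T)ᶜ ∪ ws T ∪ zs T
    set D := (S ∪ T)ᶜ ∪ T with hD
    have h1 : Det h B (xs D) :=
      E.det_mono (E.det_xs D) (by rw [Var.subset_iff]; grind [Finset.mem_compl])
    have h2 : Det h B (ys Usᶜ) := by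
      refine E.det_trans h1 (E.det_ys _ _ ?_)
      intro u hu i hi
      rw [hD, hU]
      rw [mem_cluster] at hi
      simp only [Finset.mem_union, Finset.mem_compl, mem_clusters, hi] at hu ⊢
      tauto
    have h3 : Det h B (ys Finset.univ) := by
      refine E.det_of_subset (E.det_union h2 (E.det_subset (A := ys Us) (by grind))) ?_
      rw [Var.subset_iff]; grind [Finset.mem_compl]
    exact E.det_trans h3 E.det_total

/-- A relay message has room to reveal just one input of its cluster. One representative in `S` is
chosen per relay; distinct relays have distinct representatives, and each is determined by its
relay's message given the cluster's keys and other inputs. -/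
theorem server_keys {Us : Finset (Fin U)} {S T : Finset (User V)} (hS : S ∈ 𝒮) (hT : T ∈ 𝒯)
    (hU : S ∪ T = clusters V Us ∪ T) (hST : Disjoint S T)
    (hrep : ∀ u ∈ Us, (S ∩ cluster V u).Nonempty) (huniv : S ∪ T ≠ Finset.univ) :
    Us.card * L + h (zs T) ≤ h (zs T ∪ zs S) := by
  have hcl : ∀ u ∈ Us, cluster V u ⊆ S ∪ T := by
    intro u hu i hi
    rw [hU]
    exact Finset.mem_union_left _ (mem_clusters.2 (by rwa [mem_cluster.1 hi]))
  have : Nonempty (User V) := by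
    by_contra hemp
    rw [not_nonempty_iff] at hemp
    exact huniv (Finset.eq_univ_of_forall fun i => hemp.elim i)
  choose! r hr using hrep
  have hr1 : ∀ u ∈ Us, r u ∈ S := fun u hu => (Finset.mem_inter.1 (hr u hu)).1
  have hr2 : ∀ u ∈ Us, (r u).1 = u := fun u hu => mem_cluster.1 (Finset.mem_inter.1 (hr u hu)).2
  have hinj : Set.InjOn r Us := by
    intro a ha b hb hab
    rw [← hr2 a ha, ← hr2 b hb, hab]
  rw [← Finset.card_image_of_injOn hinj]
  refine E.le_keys (Rp := Us.image r) ?_ (E.server_secret hS hT hST huniv Us) ?_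
  · intro i hi
    obtain ⟨u, hu, rfl⟩ := Finset.mem_image.1 hi
    exact hr1 u hu
  · refine E.det_of_forall fun v hv => ?_
    obtain ⟨i, hi, rfl⟩ := Finset.mem_image.1 hv
    obtain ⟨u, hu, rfl⟩ := Finset.mem_image.1 hi
    have h1 := E.det_input (M := ys {u}) (D := cluster V u) (i := r u)
      (mem_cluster.2 (hr2 u hu)) ?_ ?_
    · refine E.det_mono h1 ?_
      have key : (cluster V u).erase (r u) ⊆ (S \ Us.image r) ∪ T := by
        intro j hj
        obtain ⟨hj1, hj2⟩ := Finset.mem_erase.1 hj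
        have hj3 := hcl u hu hj2
        by_cases hjT : j ∈ T
        · exact Finset.mem_union_right _ hjT
        · refine Finset.mem_union_left _ (Finset.mem_sdiff.2 ⟨by grind, ?_⟩)
          intro hj4
          obtain ⟨u', hu', rfl⟩ := Finset.mem_image.1 hj4
          have : u' = u := by rw [← hr2 u' hu', mem_cluster.1 hj2]
          exact hj1 (by rw [this])
      have h2 := hcl u hu
      rw [Var.subset_iff]; grind
    · exact E.det_trans (E.det_xs _) (E.det_ys {u} _ (by simp))
    · set B := ys {u} ∪ ws (cluster V u)ᶜ ∪ zs (cluster V u)ᶜ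
      have h1 : Det h B (xs (cluster V u)ᶜ) :=
        E.det_mono (E.det_xs _) (by grind)
      have h2 : Det h B (ys {u}ᶜ) := by
        refine E.det_trans h1 (E.det_ys _ _ ?_)
        intro u' hu' i hi
        simp only [Finset.mem_compl, Finset.mem_singleton, mem_cluster] at *
        rwa [hi]
      have h3 : Det h B (ys Finset.univ) := by
        refine E.det_of_subset (E.det_union h2 (E.det_subset (A := ys {u}) (by grind))) ?_
        rw [Var.subset_iff]; grind [Finset.mem_compl]
      exact E.det_trans h3 E.det_total

/-- `C` is a cover whose complement holds at least `L` units of key entropy unknown to `T`. -/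
structure IsEdge (𝒮 : Finset (Finset (User V))) (h : Finset (Var V) → ℝ) (L : ℝ)
    (C T : Finset (User V)) : Prop where
  subset_union : C ⊆ T ∪ explicitSet V 𝒮
  le : L + h (zs T) ≤ h (zs T ∪ zs Cᶜ)

variable (h𝒮 : ∀ S ∈ 𝒮, ∀ S' ⊆ S, S' ∈ 𝒮) (h𝒯 : ∀ T ∈ 𝒯, ∀ T' ⊆ T, T' ∈ 𝒯)

omit E in
theorem subset_explicit {S : Finset (User V)} (hS : S ∈ 𝒮) : S ⊆ explicitSet V 𝒮 :=
  fun _ hi => Finset.mem_biUnion.2 ⟨S, hS, hi⟩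

include h𝒮

omit E in
theorem singleton_mem {i : User V} (hi : i ∈ explicitSet V 𝒮) : {i} ∈ 𝒮 := by
  obtain ⟨S, hS, hiS⟩ := Finset.mem_biUnion.1 hi
  exact h𝒮 S hS _ (by simpa using hiS)

theorem isEdge_relayCover {u : Fin U} {S T : Finset (User V)} (hS : S ∈ 𝒮) (hT : T ∈ 𝒯)
    (hne : relayCover V u S T ≠ T) : IsEdge 𝒮 h L (relayCover V u S T) T := by
  have hS' : (S ∩ cluster V u) \ T ∈ 𝒮 := h𝒮 S hS _ (by grind)
  have heq : (S ∩ cluster V u) \ T ∪ T = relayCover V u S T := Finset.sdiff_union_self_eq_union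
  refine ⟨?_, ?_⟩
  · have := subset_explicit hS
    rw [← heq]
    grind
  · rw [← heq]
    refine E.relay_edge hS' hT (u := u) (by grind) Finset.sdiff_disjoint ?_
    rw [Finset.nonempty_iff_ne_empty]
    intro h0
    rw [h0, Finset.empty_union] at heq
    exact hne heq.symm

theorem isEdge_serverCover {S T : Finset (User V)} (hS : S ∈ 𝒮) (hT : T ∈ 𝒯)
    (hne : serverCover V S T ≠ T) (huniv : serverCover V S T ≠ Finset.univ) :
    IsEdge 𝒮 h L (serverCover V S T) T := by
  have hS' := h𝒮 S hS _ (serverCover_sdiff_subset S T)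
  have heq : serverCover V S T \ T ∪ T = serverCover V S T :=
    Finset.sdiff_union_of_subset (subset_serverCover S T)
  refine ⟨?_, ?_⟩
  · have := subset_explicit hS'
    rw [← heq]
    grind
  · have := E.server_edge (Us := securityRelays V S T) hS' hT heq Finset.sdiff_disjoint ?_ ?_
    · rwa [heq] at this
    · rw [Finset.nonempty_iff_ne_empty]
      intro h0
      rw [h0, Finset.empty_union] at heq
      exact hne heq.symm
    · rwa [heq]

include h𝒯

/-- Such a cover arises from a collusion set that contains a user of the explicit security set. -/
theorem isEdge_self {i : User V} {T : Finset (User V)} (hi : i ∈ explicitSet V 𝒮) (hT : T ∈ 𝒯)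
    (hiT : i ∈ T) : IsEdge 𝒮 h L T (T.erase i) := by
  have hT' := h𝒯 T hT _ (Finset.erase_subset i T)
  have heq : {i} ∪ T.erase i = T := by
    rw [← Finset.insert_eq, Finset.insert_erase hiT]
  refine ⟨by grind, ?_⟩
  have := E.relay_edge (u := i.1) (singleton_mem h𝒮 hi) hT' (by simp) (by simp) (by simp)
  rwa [heq] at this

variable (hcard : ∀ T ∈ 𝒯, T.card + 2 ≤ numUsers V)

include hcard

omit h𝒯 in
-- The defining cover of an implicit user has `K - 1` elements, whereas `T` has at most `K - 2`. So
-- the cover is not just `T`, and it comes from a non-empty protected set.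
theorem exists_isEdge_of_implicit {i : User V}
    (hi : i ∈ implicitRelaySet V 𝒮 𝒯 ∪ implicitServerSet V 𝒮 𝒯) :
    i ∉ explicitSet V 𝒮 ∧ ∃ C T, IsEdge 𝒮 h L C T ∧ Cᶜ = {i} := by
  have aux : ∀ C : Finset (User V), C.card + 1 = numUsers V → i ∈ Cᶜ → Cᶜ = {i} := by
    intro C hC hiC
    have h1 := Finset.card_compl_add_card C
    rw [card_user] at h1
    obtain ⟨j, hj⟩ := Finset.card_eq_one.1 (show Cᶜ.card = 1 by omega)
    rw [hj] at hiC ⊢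
    rw [Finset.mem_singleton.1 hiC]
  rcases Finset.mem_union.1 hi with hi | hi
  · simp only [implicitRelaySet, Finset.mem_sdiff, Finset.mem_biUnion, Finset.mem_filter,
      triples, Finset.mem_product, Finset.mem_univ, true_and] at hi
    obtain ⟨⟨⟨u, S, T⟩, ⟨⟨hS, hT⟩, hc⟩, hiC⟩, hex⟩ := hi
    refine ⟨hex, _, T, E.isEdge_relayCover h𝒮 (u := u) hS hT ?_, aux _ hc hiC⟩
    intro heq
    have := hcard T hT
    simp only [heq] at hc
    omega
  · simp only [implicitServerSet, Finset.mem_sdiff, Finset.mem_biUnion, Finset.mem_filter,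
      Finset.mem_product] at hi
    obtain ⟨⟨⟨S, T⟩, ⟨⟨hS, hT⟩, hc⟩, hiC⟩, hex⟩ := hi
    refine ⟨hex, _, T, E.isEdge_serverCover h𝒮 hS hT ?_ ?_, aux _ hc hiC⟩
    · intro heq
      have := hcard T hT
      simp only [heq] at hc
      omega
    · intro heq
      simp only [heq, card_univ_user] at hc
      omega

omit h𝒯 in
-- The edge of `a` misses only `a`, so it contains all other implicit users; not being explicit,
-- they must lie in its collusion set. The key of `a` therefore has `L` fresh units given all their
-- keys.
theorem implicit_keys (A : Finset (User V))
    (hA : A ⊆ implicitRelaySet V 𝒮 𝒯 ∪ implicitServerSet V 𝒮 𝒯) :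
    A.card * L ≤ h (zs A) := by
  induction A using Finset.induction_on with
  | empty => simp [zs, E.empty]
  | insert a s ha ih =>
    have ih' := ih fun i hi => hA (Finset.mem_insert_of_mem hi)
    obtain ⟨-, C, T, hE, hC⟩ :=
      E.exists_isEdge_of_implicit h𝒮 hcard (hA (Finset.mem_insert_self a s))
    have hsT : s ⊆ T := by
      intro i hi
      have h1 := (E.exists_isEdge_of_implicit h𝒮 hcard
        (hA (Finset.mem_insert_of_mem hi))).1
      have h2 : i ∈ C := by
        by_contra hiC
        rw [← Finset.mem_compl, hC, Finset.mem_singleton] at hiC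
        exact ha (hiC ▸ hi)
      have := hE.subset_union h2
      grind
    have h1 := E.sm (A := zs (insert a s)) (B := zs T) (P := zs T ∪ zs {a}) (Q := zs s)
      (by rw [Var.subset_iff]; grind) (by rw [Var.subset_iff]; grind)
      (by rw [Var.subset_iff]; grind)
    have h2 := hE.le
    rw [hC] at h2
    rw [Finset.card_insert_of_notMem ha]
    push_cast
    linarith

omit hcard in
-- The users of `T` other than `a` also form a collusion set, and `{a}` is a security set. So
-- `relay_keys` makes the key of `a` fresh given all other keys of `T`.
theorem explicit_keys {T : Finset (User V)} (hT : T ∈ 𝒯) (I A : Finset (User V))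
    (hIA : Disjoint I A) (hI : I ⊆ T) (hAT : A ⊆ T) (hA : A ⊆ explicitSet V 𝒮) :
    A.card * L + h (zs I) ≤ h (zs (I ∪ A)) := by
  induction A using Finset.induction_on with
  | empty => simp
  | insert a s ha ih =>
    have ih' := ih (by grind) (by grind) (by grind)
    have hT' := h𝒯 T hT _ (Finset.erase_subset a T)
    have h1 := E.relay_keys (u := a.1) (singleton_mem h𝒮 (hA (Finset.mem_insert_self a s))) hT'
      (by simp) (by simp)
    have haI : a ∉ I := fun h => Finset.disjoint_left.1 hIA h (Finset.mem_insert_self a s)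
    have h2 := E.sm (A := zs (I ∪ insert a s)) (B := zs (T.erase a))
      (P := zs (T.erase a) ∪ zs {a}) (Q := zs (I ∪ s))
      (by rw [Var.subset_iff]; grind) (by rw [Var.subset_iff]; grind)
      (by rw [Var.subset_iff]; grind)
    rw [Finset.card_insert_of_notMem ha]
    push_cast
    rw [Finset.card_singleton] at h1
    push_cast at h1
    linarith

theorem colluding_keys {T : Finset (User V)} (hT : T ∈ 𝒯) :
    (T ∩ totalSet V 𝒮 𝒯).card * L ≤ h (zs T) := by
  set I := T ∩ (implicitRelaySet V 𝒮 𝒯 ∪ implicitServerSet V 𝒮 𝒯) with hI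
  set A := T ∩ explicitSet V 𝒮 with hA
  have hdisj : Disjoint I A := by
    rw [Finset.disjoint_left]
    intro i hi hi'
    exact (E.exists_isEdge_of_implicit h𝒮 hcard (Finset.mem_inter.1 hi).2).1
      (Finset.mem_inter.1 hi').2
  have heq : T ∩ totalSet V 𝒮 𝒯 = I ∪ A := by
    rw [totalSet, Finset.inter_union_distrib_left, Finset.union_comm]
  have h1 := E.implicit_keys h𝒮 hcard I (by grind)
  have h2 := E.explicit_keys h𝒮 h𝒯 hT I A hdisj (by grind) (by grind) (by grind)
  have h3 := E.mono (zs (I ∪ A)) (zs T) (by rw [Var.subset_iff]; grind)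
  rw [heq, Finset.card_union_of_disjoint hdisj]
  push_cast
  linarith

omit h𝒮 h𝒯 hcard in
theorem rate_nonneg : 0 ≤ R := by
  have h1 := E.mono ∅ (zs Finset.univ) (by simp)
  have h2 := E.keys_le
  rw [E.empty] at h1
  exact nonneg_of_mul_nonneg_left (h1.trans h2) E.L_pos

theorem aStar_le_rate : (aStar V 𝒮 𝒯 : ℝ) ≤ R := by
  have hR := E.rate_nonneg
  -- The supremum is taken in `ℕ`, so it is compared with the floor of the rate.
  refine (Nat.le_floor_iff hR).1 (Finset.sup_le ?_)
  rintro ⟨u, S, T⟩ hp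
  simp only [triples, Finset.mem_product, Finset.mem_univ, true_and] at hp
  rw [Nat.le_floor_iff hR]
  have hS' : (S ∩ cluster V u) \ T ∈ 𝒮 := h𝒮 S hp.1 _ (by grind)
  have h1 := E.relay_keys (u := u) hS' hp.2 (by grind) Finset.sdiff_disjoint
  have h2 := E.colluding_keys h𝒮 h𝒯 hcard hp.2
  have h3 := E.mono (zs T ∪ zs ((S ∩ cluster V u) \ T)) (zs Finset.univ)
    (by rw [Var.subset_iff]; grind)
  have h4 := E.keys_le
  have h5 : (setA V 𝒮 𝒯 u S T).card
      ≤ (T ∩ totalSet V 𝒮 𝒯).card + ((S ∩ cluster V u) \ T).card := by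
    refine (Finset.card_le_card ?_).trans (Finset.card_union_le _ _)
    intro i hi
    simp only [setA, relayCover] at hi
    grind
  have h6 : ((setA V 𝒮 𝒯 u S T).card : ℝ)
      ≤ (T ∩ totalSet V 𝒮 𝒯).card + ((S ∩ cluster V u) \ T).card := by exact_mod_cast h5
  refine le_of_mul_le_mul_right ?_ E.L_pos
  have h7 := mul_le_mul_of_nonneg_right h6 E.L_pos.le
  simp only at *
  linarith

theorem dStar_le_rate (hcov : ∀ S ∈ 𝒮, ∀ T ∈ 𝒯, (serverCover V S T).card < numUsers V) :
    (dStar V 𝒮 𝒯 : ℝ) ≤ R := by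
  have hR := E.rate_nonneg
  refine (Nat.le_floor_iff hR).1 (Finset.sup_le ?_)
  rintro ⟨S, T⟩ hp
  simp only [disjointPairs, Finset.mem_filter, Finset.mem_product] at hp
  obtain ⟨⟨hS, hT⟩, hST⟩ := hp
  rw [Nat.le_floor_iff hR]
  -- `S` is cut down to the users of its security relays outside `T`. Disjointness of `S` and `T`
  -- keeps a representative in every such cluster.
  have hS' := h𝒮 S hS _ (serverCover_sdiff_subset S T)
  have heq : serverCover V S T \ T ∪ T = serverCover V S T :=
    Finset.sdiff_union_of_subset (subset_serverCover S T)
  have h1 := E.server_keys (Us := securityRelays V S T) hS' hT heq Finset.sdiff_disjoint ?_ ?_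
  · have h2 := E.colluding_keys h𝒮 h𝒯 hcard hT
    have h3 := E.mono (zs T ∪ zs (serverCover V S T \ T)) (zs Finset.univ)
      (by rw [Var.subset_iff]; grind)
    have h4 := E.keys_le
    refine le_of_mul_le_mul_right ?_ E.L_pos
    simp only [dValue]
    push_cast
    linarith
  · intro u hu
    obtain ⟨⟨i, hi⟩, -⟩ := mem_securityRelays.1 hu
    refine ⟨i, ?_⟩
    rw [Finset.mem_inter] at hi
    simp only [Finset.mem_inter, Finset.mem_sdiff, serverCover, Finset.mem_union, mem_clusters]
    refine ⟨⟨Or.inl (by rwa [mem_cluster.1 hi.2]), ?_⟩, hi.2⟩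
    intro hiT
    have : i ∈ S ∩ T := Finset.mem_inter.2 ⟨hi.1, hiT⟩
    simp [hST] at this
  · rw [heq]
    intro h0
    have := hcov S hS T hT
    rw [h0, card_univ_user] at this
    exact lt_irrefl _ this

omit h𝒮 h𝒯 hcard in
/-- Weights given by the chain rule for the keys of `N`. -/
theorem exists_chain_weights (N : Finset (User V)) : ∃ l : User V → ℝ, (∀ i ∈ N, 0 ≤ l i) ∧
    ∑ i ∈ N, l i = h (zs N) ∧
    ∀ e ⊆ N, h (zs N) - h (zs (N \ e)) ≤ ∑ i ∈ e, l i := by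
  induction N using Finset.induction_on with
  | empty =>
    refine ⟨0, by simp, by simp [zs, E.empty], fun e he => ?_⟩
    rw [Finset.subset_empty.1 he]
    simp
  | insert a N ha ih =>
    obtain ⟨l, h0, hs, he⟩ := ih
    -- The new user gets the entropy of its key conditioned on those already treated.
    set l' := Function.update l a (h (zs (insert a N)) - h (zs N)) with hl'
    have hl : ∀ e : Finset (User V), a ∉ e → ∑ i ∈ e, l' i = ∑ i ∈ e, l i := by
      intro e hae
      refine Finset.sum_congr rfl fun i hi => ?_
      rw [hl', Function.update_of_ne]
      rintro rfl
      exact hae hi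
    have hla : l' a = h (zs (insert a N)) - h (zs N) := by simp [hl']
    refine ⟨l', ?_, ?_, ?_⟩
    · intro i hi
      by_cases hia : i = a
      · have := E.mono (zs N) (zs (insert a N)) (by rw [Var.subset_iff]; grind)
        rw [hia, hla]
        linarith
      · rw [hl', Function.update_of_ne hia]
        exact h0 i (by grind)
    · rw [Finset.sum_insert ha, hl N ha, hla, hs]
      ring
    · intro e heN
      by_cases hae : a ∈ e
      · have h1 := he (e.erase a) (by grind)
        rw [← Finset.add_sum_erase e _ hae, hl _ (Finset.notMem_erase a e), hla]
        have h2 : insert a N \ e = N \ e.erase a := by grind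
        rw [h2]
        linarith
      · have h1 := he e (by grind)
        rw [hl e hae]
        -- Conditioning additionally on the key of `a` only lowers the conditional entropy of the
        -- keys of `e`.
        have h2 := E.sm (A := zs N) (B := zs (insert a N \ e)) (P := zs (insert a N))
          (Q := zs (N \ e)) (by rw [Var.subset_iff]; grind) (by rw [Var.subset_iff]; grind)
          (by rw [Var.subset_iff]; grind)
        linarith

omit h𝒮 h𝒯 hcard in
-- Outside the total set every user of `C` belongs to `T`. Hence, given only the keys of these
-- users, the keys of `Cᶜ` have at least the entropy they have given those of `T`.
theorem IsEdge.le_chain {C T : Finset (User V)} (hC : IsEdge 𝒮 h L C T)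
    (hcov : totalSet V 𝒮 𝒯 ⊆ C) :
    L ≤ h (zs (totalSet V 𝒮 𝒯)ᶜ) - h (zs ((totalSet V 𝒮 𝒯)ᶜ \ Cᶜ)) := by
  have hex : explicitSet V 𝒮 ⊆ totalSet V 𝒮 𝒯 := Finset.subset_union_left
  have h1 := hC.subset_union
  have h2 := E.sm (A := zs T) (B := zs (totalSet V 𝒮 𝒯)ᶜ) (P := zs T ∪ zs Cᶜ)
    (Q := zs ((totalSet V 𝒮 𝒯)ᶜ \ Cᶜ)) (by rw [Var.subset_iff]; grind [Finset.mem_compl])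
    (by rw [Var.subset_iff]; grind [Finset.mem_compl])
    (by rw [Var.subset_iff]; grind [Finset.mem_compl])
  have h3 := hC.le
  linarith

omit hcard in
/-- If some user needs protection, the optimal value of the linear program is a lower bound for
the rate. -/
theorem exists_lpValue_le (hcov : ∀ S ∈ 𝒮, ∀ T ∈ 𝒯, (serverCover V S T).card < numUsers V)
    (hne : ∃ S ∈ 𝒮, S.Nonempty) : ∃ x ∈ lpValues V 𝒮 𝒯, x ≤ R := by
  obtain ⟨l, h0, hs, he⟩ := E.exists_chain_weights (totalSet V 𝒮 𝒯)ᶜ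
  obtain ⟨S₀, hS₀, i, hi⟩ := hne
  have hi' : i ∈ explicitSet V 𝒮 := subset_explicit hS₀ hi
  have hit : i ∈ totalSet V 𝒮 𝒯 := Finset.mem_union_left _ hi'
  have hL := E.L_pos
  have cover : ∀ C T, IsEdge 𝒮 h L C T → totalSet V 𝒮 𝒯 ⊆ C → 1 ≤ ∑ i ∈ Cᶜ, l i / L := by
    intro C T hC hsub
    rw [← Finset.sum_div, le_div_iff₀ hL, one_mul]
    exact (IsEdge.le_chain E hC hsub).trans (he Cᶜ (Finset.compl_subset_compl.2 hsub))
  have sub : ∀ C : Finset (User V), (C ∩ totalSet V 𝒮 𝒯).card = (totalSet V 𝒮 𝒯).card →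
      totalSet V 𝒮 𝒯 ⊆ C := by
    intro C hC
    rw [← Finset.inter_eq_right]
    exact Finset.eq_of_subset_of_card_le Finset.inter_subset_right hC.ge
  refine ⟨_, ⟨fun i => l i / L, ⟨?_, ?_, ?_⟩, rfl⟩, ?_⟩
  · intro u S hS T hT hc
    have hsub := sub _ hc
    -- If the cover is only `T`, no protected user is left outside `T`. An explicit user `i` exists
    -- and lies in `T`, so it is removed from the collusion set and protected instead.
    by_cases heq : relayCover V u S T = T
    · rw [heq] at hsub ⊢
      exact cover _ _ (E.isEdge_self h𝒮 h𝒯 hi' hT (hsub hit)) hsub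
    · exact cover _ _ (E.isEdge_relayCover h𝒮 hS hT heq) hsub
  · intro S hS T hT hc
    have hsub := sub _ hc
    by_cases heq : serverCover V S T = T
    · rw [heq] at hsub ⊢
      exact cover _ _ (E.isEdge_self h𝒮 h𝒯 hi' hT (hsub hit)) hsub
    · refine cover _ _ (E.isEdge_serverCover h𝒮 hS hT heq ?_) hsub
      intro h0
      have := hcov S hS T hT
      rw [h0, card_univ_user] at this
      exact lt_irrefl _ this
  · intro i hi
    exact div_nonneg (h0 i hi) hL.le
  · rw [← Finset.sum_div, hs, div_le_iff₀ hL]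
    exact (E.mono _ _ (by rw [Var.subset_iff]; grind)).trans E.keys_le

end SchemeEntropy

-- The joint entropy of an actual scheme satisfies these inequalities.

universe u

theorem joint_eq_iff {Ω ι : Type*} {α : ι → Type*} {A : Finset ι} {f : (i : ι) → Ω → α i}
    {ω ω' : Ω} : joint A f ω = joint A f ω' ↔ ∀ i ∈ A, f i ω = f i ω' := by
  constructor
  · intro h i hi
    exact congrFun h ⟨i, hi⟩
  · intro h
    funext i
    exact h i.1 i.2

theorem Var.forall_iff {U : ℕ} {V : Fin U → ℕ} {p : Var V → Prop} : (∀ v, p v) ↔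
    (∀ i, p (.w i)) ∧ (∀ i, p (.z i)) ∧ (∀ i, p (.x i)) ∧ (∀ u, p (.y u)) ∧ p .sum := by
  refine ⟨fun h => ⟨fun _ => h _, fun _ => h _, fun _ => h _, fun _ => h _, h _⟩, ?_⟩
  rintro ⟨h1, h2, h3, h4, h5⟩ (i | i | i | u | _)
  exacts [h1 i, h2 i, h3 i, h4 u, h5]

section

variable {F : Type u} [Field F] [Fintype F] {U : ℕ} {V : Fin U → ℕ}
  {𝒮 𝒯 : Finset (Finset (User V))} (s : Scheme F V 𝒮 𝒯)

namespace Scheme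

instance (i : User V) : Fintype (s.Key i) := s.keyFintype i

def Alphabet : Var V → Type u
  | .w _ => Fin s.L → F
  | .z i => s.Key i
  | .x _ => Fin s.LX → F
  | .y _ => Fin s.LY → F
  | .sum => Fin s.L → F

noncomputable instance alphabetFintype : (v : Var V) → Fintype (s.Alphabet v)
  | .w _ => inferInstanceAs (Fintype (Fin s.L → F))
  | .z i => s.keyFintype i
  | .x _ => inferInstanceAs (Fintype (Fin s.LX → F))
  | .y _ => inferInstanceAs (Fintype (Fin s.LY → F))
  | .sum => inferInstanceAs (Fintype (Fin s.L → F))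

def rv : (v : Var V) → s.Ω → s.Alphabet v
  | .w i => s.W i
  | .z i => s.Z i
  | .x i => s.X i
  | .y u => s.Y u
  | .sum => fun ω => (∑ i, s.W i ω : Fin s.L → F)

section
variable {ω ω' : s.Ω} {i : User V} {u : Fin U}

theorem rv_w : s.rv (.w i) ω = s.rv (.w i) ω' ↔ s.W i ω = s.W i ω' := Iff.rfl
theorem rv_z : s.rv (.z i) ω = s.rv (.z i) ω' ↔ s.Z i ω = s.Z i ω' := Iff.rfl
theorem rv_x : s.rv (.x i) ω = s.rv (.x i) ω' ↔ s.X i ω = s.X i ω' := Iff.rfl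
theorem rv_y : s.rv (.y u) ω = s.rv (.y u) ω' ↔ s.Y u ω = s.Y u ω' := Iff.rfl
theorem rv_sum : s.rv .sum ω = s.rv .sum ω' ↔ ∑ i, s.W i ω = ∑ i, s.W i ω' := Iff.rfl

end

/-- The joint entropy of a set of variables of a scheme. -/
noncomputable def jointEntropy (A : Finset (Var V)) : ℝ :=
  entropy (Fintype.card F) s.μ (joint A s.rv)

/-- Entropy depends only on the partition into fibres, so the nested tuples in the definition of a
scheme may be exchanged for sets of variables. -/
theorem jointEntropy_eq {α : Type*} [Fintype α] (A : Finset (Var V)) (f : s.Ω → α)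
    (hf : ∀ ω ω', f ω = f ω' ↔ ∀ v ∈ A, s.rv v ω = s.rv v ω') :
    s.jointEntropy A = entropy (Fintype.card F) s.μ f :=
  entropy_congr _ _ _ _ fun ω ω' => by rw [hf, joint_eq_iff]

open Var

theorem schemeEntropy : SchemeEntropy V 𝒮 𝒯 s.jointEntropy s.L s.keyRate where
  L_pos := by exact_mod_cast s.L_pos
  empty := by
    have h1 : s.jointEntropy ∅ = entropy (Fintype.card F) s.μ (fun _ => ()) :=
      s.jointEntropy_eq _ _ (by simp)
    have h2 := entropy_of_uniform (Fintype.card F) s.μ (fun _ => ()) (by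
      ext a
      simp [PMF.uniformOfFintype_apply])
    rw [h1, h2]
    simp
  mono A B hAB := entropy_le_of_factors _ _ _ _ fun ω ω' => by
    simp only [joint_eq_iff]
    exact fun h i hi => h i (hAB hi)
  submod A B := by
    have h := entropy_submodular (Fintype.card F) s.μ (joint A s.rv) (joint B s.rv)
      (joint (A ∩ B) s.rv)
    have h1 := s.jointEntropy_eq (A ∪ B)
      (fun ω => (joint A s.rv ω, joint B s.rv ω, joint (A ∩ B) s.rv ω)) (by
        intro ω ω'
        simp only [Prod.mk.injEq, joint_eq_iff, Finset.mem_union, Finset.mem_inter]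
        grind)
    have h2 := s.jointEntropy_eq A (fun ω => (joint A s.rv ω, joint (A ∩ B) s.rv ω)) (by
        intro ω ω'
        simp only [Prod.mk.injEq, joint_eq_iff, Finset.mem_inter]
        grind)
    have h3 := s.jointEntropy_eq B (fun ω => (joint B s.rv ω, joint (A ∩ B) s.rv ω)) (by
        intro ω ω'
        simp only [Prod.mk.injEq, joint_eq_iff, Finset.mem_inter]
        grind)
    rw [h1, h2, h3]
    exact h
  input_le i := by
    rw [s.jointEntropy_eq (ws {i}) (s.W i) (by intro ω ω'; simp [Var.forall_iff, rv_w, rv_z, rv_x, rv_y, rv_sum]),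
      ← log_card_fun_div (F := F)]
    exact entropy_le_log_card _ _ _
  total_le := by
    rw [s.jointEntropy_eq total (fun ω => ∑ i, s.W i ω)
      (by intro ω ω'; simp [Var.forall_iff, rv_w, rv_z, rv_x, rv_y, rv_sum]), ← log_card_fun_div (F := F)]
    exact entropy_le_log_card _ _ _
  indep := by
    rw [s.jointEntropy_eq (zs Finset.univ) (joint Finset.univ s.Z)
        (by intro ω ω'; simp [Var.forall_iff, rv_w, rv_z, rv_x, rv_y, rv_sum, joint_eq_iff]),
      s.jointEntropy_eq (ws Finset.univ ∪ zs Finset.univ)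
        (fun ω => (joint Finset.univ s.W ω, joint Finset.univ s.Z ω))
        (by intro ω ω'; simp [Var.forall_iff, rv_w, rv_z, rv_x, rv_y, rv_sum, joint_eq_iff]), s.indep]
    have : ∀ i, entropy (Fintype.card F) s.μ (s.W i) = s.L := fun i => by
      rw [entropy_of_uniform _ _ _ (s.W_uniform i), log_card_fun_div]
    simp [this]
  keys_le := by
    rw [s.jointEntropy_eq (zs Finset.univ) (joint Finset.univ s.Z)
        (by intro ω ω'; simp [Var.forall_iff, rv_w, rv_z, rv_x, rv_y, rv_sum, joint_eq_iff]), keyRate, div_mul_cancel₀ _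
        (by exact_mod_cast s.L_pos.ne')]
    have h1 := s.key_gen
    have h2 := entropy_le_of_factors (Fintype.card F) s.μ (joint Finset.univ s.Z)
      (fun ω => (joint Finset.univ s.Z ω, s.Zsrc ω)) (by simp +contextual)
    unfold condEntropy at h1
    linarith
  msgX i := by
    have h1 := s.msgX i
    unfold condEntropy at h1
    rw [s.jointEntropy_eq (ws {i} ∪ zs {i} ∪ xs {i}) (fun ω => (s.X i ω, s.W i ω, s.Z i ω))
        (by intro ω ω'; simp [Var.forall_iff, rv_w, rv_z, rv_x, rv_y, rv_sum]; tauto),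
      s.jointEntropy_eq (ws {i} ∪ zs {i}) (fun ω => (s.W i ω, s.Z i ω))
        (by intro ω ω'; simp [Var.forall_iff, rv_w, rv_z, rv_x, rv_y, rv_sum])]
    linarith
  msgY u := by
    have h1 := s.msgY u
    unfold condEntropy at h1
    rw [s.jointEntropy_eq (xs (cluster V u) ∪ ys {u})
        (fun ω => (s.Y u ω, joint (cluster V u) s.X ω))
        (by intro ω ω'; simp [Var.forall_iff, rv_w, rv_z, rv_x, rv_y, rv_sum, joint_eq_iff]; tauto),
      s.jointEntropy_eq (xs (cluster V u)) (joint (cluster V u) s.X)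
        (by intro ω ω'; simp [Var.forall_iff, rv_w, rv_z, rv_x, rv_y, rv_sum, joint_eq_iff])]
    linarith
  recovery := by
    have h1 := s.recovery
    unfold condEntropy at h1
    rw [s.jointEntropy_eq (ys Finset.univ ∪ total)
        (fun ω => (∑ i, s.W i ω, joint Finset.univ s.Y ω))
        (by intro ω ω'; simp [Var.forall_iff, rv_w, rv_z, rv_x, rv_y, rv_sum, joint_eq_iff]; tauto),
      s.jointEntropy_eq (ys Finset.univ) (joint Finset.univ s.Y)
        (by intro ω ω'; simp [Var.forall_iff, rv_w, rv_z, rv_x, rv_y, rv_sum, joint_eq_iff])]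
    linarith
  last_input i := by
    refine entropy_le_of_factors _ _ _ _ fun ω ω' h => ?_
    rw [joint_eq_iff] at h ⊢
    simp only [Var.forall_iff, Finset.mem_union, w_mem_total, z_mem_total, x_mem_total,
      y_mem_total, sum_mem_total, w_mem_ws, z_mem_ws, x_mem_ws, y_mem_ws, sum_mem_ws, rv_w, rv_sum,
      false_or, or_false, Finset.mem_erase, Finset.mem_univ, and_true, Finset.mem_singleton,
      true_implies, false_implies, implies_true, true_and, or_self] at h ⊢
    refine ⟨fun j hj => ?_, h.2⟩
    by_cases hji : j = i
    · subst hji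
      have h2 := h.2
      rw [← Finset.add_sum_erase _ _ (Finset.mem_univ j),
        ← Finset.add_sum_erase _ (fun i => s.W i ω') (Finset.mem_univ j),
        Finset.sum_congr rfl fun k hk => h.1 k (Finset.ne_of_mem_erase hk)] at h2
      exact add_right_cancel h2
    · exact h.1 j hji
  server_security S hS T hT := by
    have h1 := s.server_security S hS T hT
    unfold condMutualInfo condEntropy at h1
    rw [s.jointEntropy_eq (ys Finset.univ ∪ total ∪ ws T ∪ zs T)
        (fun ω => (joint Finset.univ s.Y ω, ∑ i, s.W i ω, joint T s.W ω, joint T s.Z ω))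
        (by intro ω ω'; simp [Var.forall_iff, rv_w, rv_z, rv_x, rv_y, rv_sum, joint_eq_iff]; tauto),
      s.jointEntropy_eq (ws S ∪ total ∪ ws T ∪ zs T)
        (fun ω => (joint S s.W ω, ∑ i, s.W i ω, joint T s.W ω, joint T s.Z ω))
        (by intro ω ω'; simp [Var.forall_iff, rv_w, rv_z, rv_x, rv_y, rv_sum, joint_eq_iff, or_imp, forall_and]),
      s.jointEntropy_eq (ys Finset.univ ∪ ws S ∪ total ∪ ws T ∪ zs T)
        (fun ω => (joint Finset.univ s.Y ω, joint S s.W ω, ∑ i, s.W i ω, joint T s.W ω,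
          joint T s.Z ω))
        (by intro ω ω'; simp [Var.forall_iff, rv_w, rv_z, rv_x, rv_y, rv_sum, joint_eq_iff, or_imp, forall_and]),
      s.jointEntropy_eq (total ∪ ws T ∪ zs T)
        (fun ω => (∑ i, s.W i ω, joint T s.W ω, joint T s.Z ω))
        (by intro ω ω'; simp [Var.forall_iff, rv_w, rv_z, rv_x, rv_y, rv_sum, joint_eq_iff]; tauto)]
    linarith
  relay_security u S hS T hT := by
    have h1 := s.relay_security u S hS T hT
    unfold condMutualInfo condEntropy at h1
    rw [s.jointEntropy_eq (xs (cluster V u) ∪ ws T ∪ zs T)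
        (fun ω => (joint (cluster V u) s.X ω, joint T s.W ω, joint T s.Z ω))
        (by intro ω ω'; simp [Var.forall_iff, rv_w, rv_z, rv_x, rv_y, rv_sum, joint_eq_iff]; tauto),
      s.jointEntropy_eq (ws S ∪ ws T ∪ zs T)
        (fun ω => (joint S s.W ω, joint T s.W ω, joint T s.Z ω))
        (by intro ω ω'; simp [Var.forall_iff, rv_w, rv_z, rv_x, rv_y, rv_sum, joint_eq_iff, or_imp, forall_and]),
      s.jointEntropy_eq (xs (cluster V u) ∪ ws S ∪ ws T ∪ zs T)
        (fun ω => (joint (cluster V u) s.X ω, joint S s.W ω, joint T s.W ω, joint T s.Z ω))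
        (by intro ω ω'; simp [Var.forall_iff, rv_w, rv_z, rv_x, rv_y, rv_sum, joint_eq_iff, or_imp, forall_and]),
      s.jointEntropy_eq (ws T ∪ zs T) (fun ω => (joint T s.W ω, joint T s.Z ω))
        (by intro ω ω'; simp [Var.forall_iff, rv_w, rv_z, rv_x, rv_y, rv_sum, joint_eq_iff])]
    linarith

end Scheme

end

/-! ### Feasibility and attainment of the linear program. -/

section LinearProgram

variable {U : ℕ} {V : Fin U → ℕ} {𝒮 𝒯 : Finset (Finset (User V))}

theorem total_subset_of_card {C : Finset (User V)}
    (hC : (C ∩ totalSet V 𝒮 𝒯).card = (totalSet V 𝒮 𝒯).card) : totalSet V 𝒮 𝒯 ⊆ C := by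
  rw [← Finset.inter_eq_right]
  exact Finset.eq_of_subset_of_card_le Finset.inter_subset_right hC.ge

theorem card_setA_le_aStar {u : Fin U} {S T : Finset (User V)} (hS : S ∈ 𝒮) (hT : T ∈ 𝒯) :
    (setA V 𝒮 𝒯 u S T).card ≤ aStar V 𝒮 𝒯 := by
  have hm : (u, S, T) ∈ triples V 𝒮 𝒯 := by
    rw [triples, Finset.mem_product, Finset.mem_product]
    exact ⟨Finset.mem_univ u, hS, hT⟩
  have h := Finset.le_sup (f := fun p : Fin U × Finset (User V) × Finset (User V) =>
    (setA V 𝒮 𝒯 p.1 p.2.1 p.2.2).card) hm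
  exact h

theorem dValue_le_dStar {S T : Finset (User V)} (hS : S ∈ 𝒮) (hT : T ∈ 𝒯) (hST : S ∩ T = ∅) :
    dValue V 𝒮 𝒯 S T ≤ dStar V 𝒮 𝒯 := by
  have hm : (S, T) ∈ disjointPairs V 𝒮 𝒯 := by
    rw [disjointPairs, Finset.mem_filter, Finset.mem_product]
    exact ⟨⟨hS, hT⟩, hST⟩
  unfold dStar
  exact Finset.le_sup (f := fun p : Finset (User V) × Finset (User V) =>
    dValue V 𝒮 𝒯 p.1 p.2) hm

/-- If the cover were everything, each non-explicit user `j` would lie in `T`. Removing `j` from `T`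
leaves a cover missing exactly `j`, so `j` is implicit. The total set would be everything and
`aStar` would reach `K`. -/
theorem relayCover_ne_univ (h𝒯 : ∀ T ∈ 𝒯, ∀ T' ⊆ T, T' ∈ 𝒯)
    (ha : aStar V 𝒮 𝒯 < numUsers V) {u : Fin U} {S T : Finset (User V)} (hS : S ∈ 𝒮)
    (hT : T ∈ 𝒯) : relayCover V u S T ≠ Finset.univ := by
  intro heq
  have htot : totalSet V 𝒮 𝒯 = Finset.univ := by
    rw [Finset.eq_univ_iff_forall]
    intro j
    by_cases hj : j ∈ explicitSet V 𝒮
    · exact Finset.mem_union_left _ hj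
    refine Finset.mem_union_right _ (Finset.mem_union_left _ ?_)
    have hjS : j ∉ S := fun h => hj (SchemeEntropy.subset_explicit hS h)
    have hjT : j ∈ T := by
      have : j ∈ relayCover V u S T := heq ▸ Finset.mem_univ j
      simp only [relayCover] at this
      grind
    have hc : relayCover V u S (T.erase j) = Finset.univ.erase j := by
      rw [← heq]
      simp only [relayCover]
      grind
    simp only [implicitRelaySet, Finset.mem_sdiff, Finset.mem_biUnion, Finset.mem_filter,
      triples, Finset.mem_product, Finset.mem_univ, true_and]
    refine ⟨⟨(u, S, T.erase j), ⟨⟨hS, h𝒯 T hT _ (Finset.erase_subset j T)⟩, ?_⟩, ?_⟩, hj⟩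
    · simp only
      rw [hc, Finset.card_erase_add_one (Finset.mem_univ j), card_univ_user]
    · simp [hc]
  have h1 := card_setA_le_aStar (u := u) hS hT
  rw [setA, heq, htot, Finset.inter_self, card_univ_user] at h1
  omega

/-- Clipping to `[0, 1]` makes the search compact. A coordinate of at least 1 satisfies a constraint
by itself after clipping, and coordinates in the total set enter no active constraint. -/
theorem LPFeasible.truncate {l : User V → ℝ} (hl : LPFeasible V 𝒮 𝒯 l) :
    LPFeasible V 𝒮 𝒯 (fun i => max 0 (min (l i) 1)) := by
  have key : ∀ C : Finset (User V), totalSet V 𝒮 𝒯 ⊆ C → 1 ≤ ∑ i ∈ Cᶜ, l i →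
      1 ≤ ∑ i ∈ Cᶜ, max 0 (min (l i) 1) := by
    intro C hC h1
    by_cases hbig : ∃ i ∈ Cᶜ, 1 ≤ l i
    · obtain ⟨i, hi, hli⟩ := hbig
      refine le_trans ?_ (Finset.single_le_sum (f := fun i => max 0 (min (l i) 1))
        (fun _ _ => le_max_left _ _) hi)
      simp [hli]
    · push Not at hbig
      refine h1.trans (Finset.sum_le_sum fun i hi => ?_)
      rw [min_eq_left (hbig i hi).le]
      exact le_max_right _ _
  refine ⟨fun u S hS T hT hc => key _ (total_subset_of_card hc) (hl.relay u S hS T hT hc),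
    fun S hS T hT hc => key _ (total_subset_of_card hc) (hl.server S hS T hT hc),
    fun i _ => le_max_left _ _⟩

theorem lpFeasible_one (h𝒯 : ∀ T ∈ 𝒯, ∀ T' ⊆ T, T' ∈ 𝒯) (hC : Condition3 V 𝒮 𝒯) :
    LPFeasible V 𝒮 𝒯 (fun _ => 1) := by
  have key : ∀ C : Finset (User V), C ≠ Finset.univ → (1 : ℝ) ≤ ∑ i ∈ Cᶜ, 1 := by
    intro C hne
    have : 1 ≤ Cᶜ.card := Finset.card_pos.2 (by
      rw [Finset.nonempty_iff_ne_empty]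
      simpa using hne)
    simpa using this
  refine ⟨fun u S hS T hT _ => key _ (relayCover_ne_univ h𝒯 hC.aStar_lt hS hT),
    fun S hS T hT _ => key _ ?_, fun _ _ => zero_le_one⟩
  intro heq
  have := hC.cover_lt S hS T hT
  rw [heq, card_univ_user] at this
  exact lt_irrefl _ this

theorem isClosed_lpFeasible : IsClosed {l : User V → ℝ | LPFeasible V 𝒮 𝒯 l} := by
  have : {l : User V → ℝ | LPFeasible V 𝒮 𝒯 l} =
      {l | ∀ u, ∀ S ∈ 𝒮, ∀ T ∈ 𝒯, (setA V 𝒮 𝒯 u S T).card = (totalSet V 𝒮 𝒯).card →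
        1 ≤ ∑ i ∈ (relayCover V u S T)ᶜ, l i} ∩
      {l | ∀ S ∈ 𝒮, ∀ T ∈ 𝒯, (setE V 𝒮 𝒯 S T).card = (totalSet V 𝒮 𝒯).card →
        1 ≤ ∑ i ∈ (serverCover V S T)ᶜ, l i} ∩ {l | ∀ i ∈ (totalSet V 𝒮 𝒯)ᶜ, 0 ≤ l i} := by
    ext l
    exact ⟨fun h => ⟨⟨h.relay, h.server⟩, h.nonneg⟩, fun h => ⟨h.1.1, h.1.2, h.2⟩⟩
  rw [this]
  simp only [Set.ofPred_forall]
  refine (IsClosed.inter ?_ ?_).inter ?_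
  · refine isClosed_iInter fun u => isClosed_iInter fun S => isClosed_iInter fun _ =>
      isClosed_iInter fun T => isClosed_iInter fun _ => isClosed_iInter fun _ => ?_
    exact isClosed_le continuous_const (by fun_prop)
  · refine isClosed_iInter fun S => isClosed_iInter fun _ =>
      isClosed_iInter fun T => isClosed_iInter fun _ => isClosed_iInter fun _ => ?_
    exact isClosed_le continuous_const (by fun_prop)
  · refine isClosed_iInter fun i => isClosed_iInter fun _ => ?_
    exact isClosed_le continuous_const (by fun_prop)

/-- The optimal value of the linear program is attained. -/
theorem isLeast_lStar (h𝒯 : ∀ T ∈ 𝒯, ∀ T' ⊆ T, T' ∈ 𝒯) (hC : Condition3 V 𝒮 𝒯) :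
    IsLeast (lpValues V 𝒮 𝒯) (lStar V 𝒮 𝒯) := by
  have hcomp : IsCompact
      (Set.Icc (0 : User V → ℝ) 1 ∩ {l : User V → ℝ | LPFeasible V 𝒮 𝒯 l}) :=
    isCompact_Icc.inter_right isClosed_lpFeasible
  obtain ⟨l, ⟨-, hl⟩, hmin⟩ := hcomp.exists_isMinOn
    ⟨fun _ => 1, ⟨fun _ => zero_le_one, fun _ => le_rfl⟩, lpFeasible_one h𝒯 hC⟩
    (f := fun l => ∑ i ∈ (totalSet V 𝒮 𝒯)ᶜ, l i) (by fun_prop)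
  have hleast : IsLeast (lpValues V 𝒮 𝒯) (∑ i ∈ (totalSet V 𝒮 𝒯)ᶜ, l i) := by
    refine ⟨⟨l, hl, rfl⟩, ?_⟩
    rintro _ ⟨l', hl', rfl⟩
    refine (hmin ⟨⟨fun _ => le_max_left _ _, fun i => ?_⟩, hl'.truncate⟩).trans
      (Finset.sum_le_sum fun i hi => ?_)
    · exact max_le zero_le_one (min_le_right _ _)
    · exact max_le (hl'.nonneg i hi) (min_le_left _ _)
  have : lStar V 𝒮 𝒯 = ∑ i ∈ (totalSet V 𝒮 𝒯)ᶜ, l i := hleast.csInf_eq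
  rw [this]
  exact hleast

end LinearProgram

/-! ### Entropy of homomorphic images of a uniform variable. -/

section UniformHom

variable {Ω α β γ : Type*} [AddCommGroup Ω] [Fintype Ω] [Fintype α] [Fintype β] [Fintype γ]

omit [Fintype α] in
theorem toReal_map_uniform (f : Ω → α) (a : α) :
    (((PMF.uniformOfFintype Ω).map f) a).toReal
      = Nat.card {ω // f ω = a} / (Fintype.card Ω : ℝ) := by
  classical
  have h := toReal_map_comp (PMF.uniformOfFintype Ω) id f a
  rw [PMF.map_id] at h
  refine h.trans ?_
  rw [Nat.card_eq_fintype_card, Fintype.card_subtype]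
  simp [PMF.uniformOfFintype_apply, div_eq_mul_inv]

omit [Fintype Ω] [Fintype α] in
theorem card_fiber_addMonoidHom [AddCommGroup α] (f : Ω →+ α) (x : Ω) :
    Nat.card {ω // f ω = f x} = Nat.card f.ker :=
  Nat.card_congr ((Equiv.subRight x).subtypeEquiv fun ω => by
    simp [AddMonoidHom.mem_ker, sub_eq_zero])

/-- The entropy of a homomorphic image of a uniform variable. -/
theorem entropy_uniform_hom [AddCommGroup α] (q : ℕ) (f : Ω →+ α) :
    entropy q (PMF.uniformOfFintype Ω) f = Real.log f.ker.index / Real.log q := by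
  classical
  unfold entropy
  simp only [← Finset.sum_div]
  congr 1
  set p : α → ℝ := fun a => (((PMF.uniformOfFintype Ω).map f) a).toReal with hp
  have hO : (0 : ℝ) < Fintype.card Ω := by exact_mod_cast Fintype.card_pos
  have hidx : ((Nat.card f.ker : ℕ) : ℝ) * f.ker.index = Fintype.card Ω := by
    rw [← Nat.card_eq_fintype_card]
    exact_mod_cast f.ker.card_mul_index
  have hker : (0 : ℝ) < Nat.card f.ker := by exact_mod_cast Nat.card_pos
  have hpf : ∀ x, p (f x) = (f.ker.index : ℝ)⁻¹ := by
    intro x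
    simp only [hp]
    rw [toReal_map_uniform, card_fiber_addMonoidHom, ← hidx]
    field_simp
  calc ∑ a, Real.negMulLog (p a)
      = ∑ a, ∑ ω with f ω = a, (Fintype.card Ω : ℝ)⁻¹ * Real.log f.ker.index := by
        refine Finset.sum_congr rfl fun a _ => ?_
        by_cases ha : ∃ x, f x = a
        · obtain ⟨x, rfl⟩ := ha
          rw [Finset.sum_const, nsmul_eq_mul, Real.negMulLog, hpf, Real.log_inv,
            ← Fintype.card_subtype, ← Nat.card_eq_fintype_card, card_fiber_addMonoidHom, ← hidx]
          have : (f.ker.index : ℝ) ≠ 0 := by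
            intro h0
            rw [h0, mul_zero] at hidx
            exact hO.ne hidx
          field_simp
        · have h0 : (Finset.univ.filter fun ω => f ω = a) = ∅ := by
            rw [Finset.filter_eq_empty_iff]
            exact fun ω _ h => ha ⟨ω, h⟩
          have hpa : p a = 0 := by
            simp only [hp]
            rw [toReal_map_uniform, Nat.card_eq_fintype_card, Fintype.card_subtype, h0]
            simp
          rw [h0, hpa]
          simp
    _ = ∑ ω : Ω, (Fintype.card Ω : ℝ)⁻¹ * Real.log f.ker.index := Finset.sum_fiberwise _ _ _
    _ = _ := by
        rw [Finset.sum_const, nsmul_eq_mul, Finset.card_univ, ← mul_assoc,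
          mul_inv_cancel₀ hO.ne', one_mul]

theorem map_uniform_of_surjective [Nonempty α] [AddCommGroup α] (f : Ω →+ α)
    (hf : Function.Surjective f) :
    (PMF.uniformOfFintype Ω).map f = PMF.uniformOfFintype α := by
  classical
  ext a
  obtain ⟨x, rfl⟩ := hf a
  rw [← ENNReal.toReal_eq_toReal_iff' (PMF.apply_ne_top _ _) (PMF.apply_ne_top _ _),
    toReal_map_uniform, card_fiber_addMonoidHom]
  have h1 : Nat.card f.ker * Fintype.card α = Fintype.card Ω := by
    rw [← Nat.card_eq_fintype_card (α := Ω), ← f.ker.card_mul_index, AddSubgroup.index_ker,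
      AddMonoidHom.range_eq_top.2 hf, ← Nat.card_eq_fintype_card]
    simp
  have h2 : (Nat.card f.ker : ℝ) ≠ 0 := by exact_mod_cast Nat.card_pos.ne'
  rw [← h1]
  simp only [PMF.uniformOfFintype_apply, Nat.cast_mul, ENNReal.toReal_inv, ENNReal.toReal_natCast]
  field_simp

omit [Fintype Ω] in
-- The second isomorphism theorem for `A ⊓ C` and `B ⊓ C`, whose join is `C`.
theorem index_inf_mul_index_inf (A B C : AddSubgroup Ω) (hC : C ≤ (A ⊓ C) ⊔ (B ⊓ C)) :
    (A ⊓ C).index * (B ⊓ C).index = C.index * (A ⊓ (B ⊓ C)).index := by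
  have h0 : (A ⊓ C) ⊔ (B ⊓ C) = C := le_antisymm (sup_le inf_le_right inf_le_right) hC
  have h1 := AddSubgroup.relIndex_mul_index (inf_le_right : A ⊓ C ≤ C)
  have h2 := AddSubgroup.relIndex_mul_index (inf_le_right : (A ⊓ C) ⊓ (B ⊓ C) ≤ B ⊓ C)
  have h3 := AddSubgroup.relIndex_sup_right (H := B ⊓ C) (K := A ⊓ C)
  rw [sup_comm, h0] at h3
  rw [AddSubgroup.inf_relIndex_right] at h2
  have h4 : (A ⊓ C) ⊓ (B ⊓ C) = A ⊓ (B ⊓ C) := by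
    ext x
    simp only [AddSubgroup.mem_inf]
    tauto
  rw [h4] at h2
  rw [← h1, ← h2, h3]
  ring

/-- Linear variables are conditionally independent if their kernels span the kernel of the
condition. -/
theorem condMutualInfo_uniform_hom [AddCommGroup α] [AddCommGroup β] [AddCommGroup γ] (q : ℕ)
    (f : Ω →+ α) (g : Ω →+ β) (h : Ω →+ γ)
    (H : ∀ x, h x = 0 → ∃ y, h y = 0 ∧ f y = 0 ∧ g y = g x) :
    condMutualInfo q (PMF.uniformOfFintype Ω) f g h = 0 := by
  have e1 := entropy_uniform_hom q (f.prod h)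
  have e2 := entropy_uniform_hom q (g.prod h)
  have e3 := entropy_uniform_hom q (f.prod (g.prod h))
  have e4 := entropy_uniform_hom q h
  rw [AddMonoidHom.ker_prod] at e1 e2 e3
  rw [AddMonoidHom.ker_prod] at e3
  have key := index_inf_mul_index_inf f.ker g.ker h.ker (by
    intro x hx
    obtain ⟨y, hy1, hy2, hy3⟩ := H x hx
    rw [← add_sub_cancel y x]
    refine AddSubgroup.add_mem_sup ⟨hy2, hy1⟩ ⟨?_, ?_⟩
    · simp [hy3]
    · rw [SetLike.mem_coe, AddMonoidHom.mem_ker] at *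
      simp [hy1, hx])
  have pos : ∀ A : AddSubgroup Ω, (A.index : ℝ) ≠ 0 := fun A => by
    exact_mod_cast A.index_ne_zero_of_finite
  have key' : Real.log (f.ker ⊓ h.ker).index + Real.log (g.ker ⊓ h.ker).index
      = Real.log h.ker.index + Real.log (f.ker ⊓ (g.ker ⊓ h.ker)).index := by
    rw [← Real.log_mul (pos _) (pos _), ← Real.log_mul (pos _) (pos _)]
    exact_mod_cast congrArg (fun n : ℕ => Real.log n) key
  unfold condMutualInfo condEntropy
  change entropy q _ (f.prod h) - entropy q _ h
    - (entropy q _ (f.prod (g.prod h)) - entropy q _ (g.prod h)) = 0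
  rw [e1, e2, e3, e4]
  have : (Real.log (f.ker ⊓ h.ker).index + Real.log (g.ker ⊓ h.ker).index) / Real.log q
      = (Real.log h.ker.index + Real.log (f.ker ⊓ (g.ker ⊓ h.ker)).index) / Real.log q := by
    rw [key']
  rw [add_div, add_div] at this
  linarith

end UniformHom

theorem condEntropy_eq_zero {Ω α β : Type*} [Fintype α] [Fintype β] (q : ℕ) (μ : PMF Ω)
    (f : Ω → α) (g : Ω → β) (h : ∀ ω ω', g ω = g ω' → f ω = f ω') : condEntropy q μ f g = 0 := by
  rw [condEntropy, sub_eq_zero]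
  refine entropy_congr _ _ _ _ fun ω ω' => ?_
  simp only [Prod.mk.injEq]
  exact ⟨fun hg => ⟨h _ _ hg, hg⟩, fun hg => hg.2⟩

/-! ### Linear schemes: correctness and security. -/

/-- Coefficients of a linear scheme: user `i` holds the key `G i N` for the source key `N`, and
masks its input by `P i (G i N)`. -/
structure LinearCode (F : Type u) [Field F] {U : ℕ} (V : Fin U → ℕ)
    (𝒮 𝒯 : Finset (Finset (User V))) (L LZ : ℕ) where
  n : User V → ℕ
  P : (i : User V) → (Fin (n i) → F) →ₗ[F] (Fin L → F)
  G : (i : User V) → (Fin LZ → F) →ₗ[F] (Fin (n i) → F)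
  sum_eq_zero : ∀ N, ∑ i, P i (G i N) = 0
  relay : ∀ u, ∀ S ∈ 𝒮, ∀ T ∈ 𝒯, ∀ w : User V → (Fin L → F), ∃ N, (∀ i ∈ T, G i N = 0) ∧
    ∀ i ∈ (S ∩ cluster V u) \ T, P i (G i N) = w i
  server : ∀ S ∈ 𝒮, ∀ T ∈ 𝒯, ∀ w : Fin U → (Fin L → F), ∃ N, (∀ i ∈ T, G i N = 0) ∧
    ∀ u ∈ securityRelays V (S \ T) T, ∑ i ∈ cluster V u \ T, P i (G i N) = w u

namespace LinearCode

variable {F : Type u} [Field F] {U : ℕ} {V : Fin U → ℕ}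
  {𝒮 𝒯 : Finset (Finset (User V))} {L LZ : ℕ} (c : LinearCode F V 𝒮 𝒯 L LZ)

/-- The sample space: all inputs and the source key. -/
abbrev Space (F : Type u) {U : ℕ} (V : Fin U → ℕ) (L LZ : ℕ) : Type u :=
  (User V → Fin L → F) × (Fin LZ → F)

def input (i : User V) : Space F V L LZ →+ (Fin L → F) :=
  (Pi.evalAddMonoidHom _ i).comp (AddMonoidHom.fst _ _)

def key (i : User V) : Space F V L LZ →+ (Fin (c.n i) → F) :=
  (c.G i).toAddMonoidHom.comp (AddMonoidHom.snd _ _)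

def userMsg (i : User V) : Space F V L LZ →+ (Fin L → F) :=
  input i + (c.P i).toAddMonoidHom.comp (c.key i)

def relayMsg (u : Fin U) : Space F V L LZ →+ (Fin L → F) :=
  ∑ i ∈ cluster V u, c.userMsg i

/-- The joint homomorphism of a family of homomorphisms. -/
def jointHom {Ω ι : Type*} {α : ι → Type*} [AddCommGroup Ω] [∀ i, AddCommGroup (α i)]
    (A : Finset ι) (f : (i : ι) → Ω →+ α i) : Ω →+ ((i : A) → α i) :=
  AddMonoidHom.mk' (joint A fun i => f i) fun x y => by
    funext i
    exact map_add (f i) x y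

theorem jointHom_eq_zero_iff {Ω ι : Type*} {α : ι → Type*} [AddCommGroup Ω]
    [∀ i, AddCommGroup (α i)] {A : Finset ι} {f : (i : ι) → Ω →+ α i} {x : Ω} :
    jointHom A f x = 0 ↔ ∀ i ∈ A, f i x = 0 := by
  constructor
  · intro h i hi
    exact congrFun h ⟨i, hi⟩
  · intro h
    funext i
    exact h i.1 i.2

theorem jointHom_eq_iff {Ω ι : Type*} {α : ι → Type*} [AddCommGroup Ω]
    [∀ i, AddCommGroup (α i)] {A : Finset ι} {f : (i : ι) → Ω →+ α i} {x y : Ω} :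
    jointHom A f x = jointHom A f y ↔ ∀ i ∈ A, f i x = f i y :=
  joint_eq_iff (f := fun i => (f i : Ω → α i))

@[simp] theorem userMsg_apply (i : User V) (x : Space F V L LZ) :
    c.userMsg i x = x.1 i + c.P i (c.G i x.2) := rfl

@[simp] theorem relayMsg_apply (u : Fin U) (x : Space F V L LZ) :
    c.relayMsg u x = ∑ i ∈ cluster V u, (x.1 i + c.P i (c.G i x.2)) := by
  simp [relayMsg, AddMonoidHom.finsetSum_apply]

theorem sum_relay (f : User V → Fin L → F) : ∑ u, ∑ i ∈ cluster V u, f i = ∑ i, f i := by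
  simp only [cluster]
  exact Finset.sum_fiberwise _ _ _

theorem sum_relayMsg (x : Space F V L LZ) : ∑ u, c.relayMsg u x = ∑ i, x.1 i := by
  simp only [relayMsg_apply]
  rw [sum_relay, Finset.sum_add_distrib, c.sum_eq_zero, add_zero]

/-- The witness for conditional independence: inputs that agree with `x` on `S` but are invisible to
the relay and to `T`. The source key is chosen so that masks cancel the inputs of `S`; other users
of the cluster take the negative of their mask as input. -/
theorem exists_relay_witness {u : Fin U} {S T : Finset (User V)} (hS : S ∈ 𝒮) (hT : T ∈ 𝒯)
    (x : Space F V L LZ) (h1 : ∀ i ∈ T, x.1 i = 0) :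
    ∃ y : Space F V L LZ, (∀ i ∈ T, y.1 i = 0) ∧ (∀ i ∈ T, c.key i y = 0) ∧
      (∀ i ∈ cluster V u, c.userMsg i y = 0) ∧ ∀ i ∈ S, y.1 i = x.1 i := by
  obtain ⟨N, hN1, hN2⟩ := c.relay u S hS T hT fun i => - x.1 i
  refine ⟨(fun i => if i ∈ cluster V u then - c.P i (c.G i N) else x.1 i, N), ?_, ?_, ?_, ?_⟩
  · intro i hi
    simp [hN1 i hi, h1 i hi]
  · exact hN1
  · intro i hi
    rw [userMsg_apply]
    simp only [hi, if_true, neg_add_cancel]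
  · intro i hi
    by_cases hic : i ∈ cluster V u
    · simp only [hic, if_true]
      by_cases hiT : i ∈ T
      · simp [hN1 i hiT, h1 i hiT]
      · rw [hN2 i (by grind), neg_neg]
    · simp only [hic, if_false]

/-- The server sees only cluster sums. A cluster with a user outside `S ∪ T` is balanced by that
user's input, and a security relay by the choice of source key. The total then vanishes because the
masks sum to zero. -/
theorem exists_server_witness {S T : Finset (User V)} (hS : S ∈ 𝒮) (hT : T ∈ 𝒯)
    (x : Space F V L LZ) (h1 : ∀ i ∈ T, x.1 i = 0) :
    ∃ y : Space F V L LZ, ∑ i, y.1 i = 0 ∧ (∀ i ∈ T, y.1 i = 0) ∧ (∀ i ∈ T, c.key i y = 0) ∧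
      (∀ u, c.relayMsg u y = 0) ∧ ∀ i ∈ S, y.1 i = x.1 i := by
  classical
  set w₀ : User V → Fin L → F := fun i => if i ∈ S then x.1 i else 0 with hw₀
  have hw₀T : ∀ i ∈ T, w₀ i = 0 := fun i hi => by simp [hw₀, h1 i hi]
  obtain ⟨N, hN1, hN2⟩ := c.server S hS T hT fun u => - ∑ i ∈ cluster V u, w₀ i
  set r : Fin U → Fin L → F := fun u => ∑ i ∈ cluster V u, (w₀ i + c.P i (c.G i N)) with hr
  -- A cluster inside `S ∪ T` either belongs to a security relay, where `N` cancels the sum, or lies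
  -- in `T`, where inputs and keys vanish.
  have hfree : ∀ u, r u ≠ 0 → ∃ j, j ∈ cluster V u ∧ j ∉ S ∪ T := by
    intro u hu
    by_contra! hcon
    apply hu
    have hsub : cluster V u ⊆ (S \ T) ∪ T := fun i hi => by
      have := hcon i hi
      grind
    by_cases hemp : ((S \ T) ∩ cluster V u).Nonempty
    · have h2 := hN2 u (mem_securityRelays.2 ⟨hemp, hsub⟩)
      have h3 : ∑ i ∈ cluster V u, c.P i (c.G i N)
          = ∑ i ∈ cluster V u \ T, c.P i (c.G i N) := by
        symm
        refine Finset.sum_subset Finset.sdiff_subset fun i hi hi' => ?_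
        rw [hN1 i (by grind), map_zero]
      simp only [hr]
      rw [Finset.sum_add_distrib, h3, h2, add_neg_cancel]
    · refine Finset.sum_eq_zero fun i hi => ?_
      have hiT : i ∈ T := by
        by_contra hiT
        exact hemp ⟨i, by grind⟩
      rw [hw₀T i hiT, hN1 i hiT, map_zero, add_zero]
  have hd : ∀ u, ∃ d : User V → Fin L → F, (∀ i ∈ S ∪ T, d i = 0) ∧
      ∑ i ∈ cluster V u, d i = - r u := by
    intro u
    by_cases hu : r u = 0
    · exact ⟨0, fun _ _ => rfl, by simp [hu]⟩
    · obtain ⟨j, hj1, hj2⟩ := hfree u hu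
      refine ⟨Pi.single j (- r u), fun i hi => ?_, ?_⟩
      · rw [Pi.single_eq_of_ne]
        rintro rfl
        exact hj2 hi
      · rw [Finset.sum_eq_single_of_mem j hj1 fun i _ hij => Pi.single_eq_of_ne hij _,
          Pi.single_eq_same]
  choose d hd1 hd2 using hd
  have hmsg : ∀ u, c.relayMsg u (fun i => w₀ i + d i.1 i, N) = 0 := by
    intro u
    rw [relayMsg_apply]
    have : ∀ i ∈ cluster V u, w₀ i + d i.1 i + c.P i (c.G i N)
        = (w₀ i + c.P i (c.G i N)) + d u i := fun i hi => by
      rw [mem_cluster.1 hi]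
      abel
    rw [Finset.sum_congr rfl this, Finset.sum_add_distrib, hd2 u]
    exact add_neg_cancel _
  refine ⟨(fun i => w₀ i + d i.1 i, N), ?_, ?_, hN1, hmsg, ?_⟩
  · rw [← c.sum_relayMsg]
    exact Finset.sum_eq_zero fun u _ => hmsg u
  · intro i hi
    simp only [hw₀T i hi, zero_add]
    exact hd1 _ i (Finset.mem_union_right _ hi)
  · intro i hi
    simp only
    rw [hd1 _ i (Finset.mem_union_left _ hi), add_zero]
    simp [hw₀, hi]

variable [Fintype F]

theorem map_input (i : User V) : (PMF.uniformOfFintype (Space F V L LZ)).map (input i)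
    = PMF.uniformOfFintype (Fin L → F) :=
  map_uniform_of_surjective (Ω := Space F V L LZ) (input i) fun a =>
    ⟨((fun _ => a, 0) : Space F V L LZ), rfl⟩

theorem map_source : (PMF.uniformOfFintype (Space F V L LZ)).map Prod.snd
    = PMF.uniformOfFintype (Fin LZ → F) :=
  map_uniform_of_surjective (AddMonoidHom.snd (User V → Fin L → F) (Fin LZ → F)) fun a =>
    ⟨((0, a) : Space F V L LZ), rfl⟩

theorem entropy_inputs (q : ℕ) (hq : q = Fintype.card F) :
    entropy q (PMF.uniformOfFintype (Space F V L LZ))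
      (jointHom Finset.univ (input (F := F) (V := V) (L := L) (LZ := LZ)))
      = Fintype.card (User V) * L := by
  have hmap : (PMF.uniformOfFintype (Space F V L LZ)).map
      (jointHom Finset.univ (input (F := F) (V := V) (L := L) (LZ := LZ)))
      = PMF.uniformOfFintype _ :=
    map_uniform_of_surjective _ fun a => ⟨(fun i => a ⟨i, Finset.mem_univ i⟩, 0), rfl⟩
  have hpos : 0 < Real.log (Fintype.card F) :=
    Real.log_pos (by exact_mod_cast Fintype.one_lt_card)
  rw [entropy_of_uniform _ _ _ hmap, hq, div_eq_iff hpos.ne']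
  rw [Fintype.card_fun, Fintype.card_fun, Fintype.card_coe, Finset.card_univ, Fintype.card_fin]
  push_cast
  rw [Real.log_pow, Real.log_pow]
  ring

theorem entropy_inputs_keys :
    entropy (Fintype.card F) (PMF.uniformOfFintype (Space F V L LZ))
      (fun x => (jointHom Finset.univ input x, jointHom Finset.univ c.key x))
    = (∑ i : User V, entropy (Fintype.card F) (PMF.uniformOfFintype (Space F V L LZ)) (input i))
      + entropy (Fintype.card F) (PMF.uniformOfFintype (Space F V L LZ))
        (jointHom Finset.univ c.key) := by
  -- Conditioning on a constant turns the conditional criterion into plain independence of inputs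
  -- and keys.
  have h1 := condMutualInfo_uniform_hom (Fintype.card F)
    (jointHom Finset.univ (input (F := F) (V := V) (L := L) (LZ := LZ)))
    (jointHom Finset.univ c.key) (0 : Space F V L LZ →+ Unit) (by
      intro x _
      refine ⟨(0, x.2), rfl, ?_, ?_⟩
      · exact jointHom_eq_zero_iff.2 fun i _ => rfl
      · exact jointHom_eq_iff.2 fun i _ => rfl)
  have h2 := entropy_uniform_hom (Fintype.card F) (0 : Space F V L LZ →+ Unit)
  have h3 : ((0 : Space F V L LZ →+ Unit).ker).index = 1 := by
    rw [AddSubgroup.index_eq_one]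
    ext
    simp
  rw [h3, Nat.cast_one, Real.log_one, zero_div] at h2
  have h4 : ∀ i : User V, entropy (Fintype.card F) (PMF.uniformOfFintype (Space F V L LZ))
      (input i) = L := fun i => by
    rw [entropy_of_uniform _ _ _ (map_input i), log_card_fun_div]
  have h5 := entropy_inputs (V := V) (L := L) (LZ := LZ) (Fintype.card F) rfl
  rw [Finset.sum_congr rfl fun i _ => h4 i, Finset.sum_const, Finset.card_univ, nsmul_eq_mul]
  unfold condMutualInfo condEntropy at h1
  set μ := PMF.uniformOfFintype (Space F V L LZ)
  set fW := jointHom Finset.univ (input (F := F) (V := V) (L := L) (LZ := LZ))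
  set fZ := jointHom Finset.univ c.key
  have h6 : entropy (Fintype.card F) μ fW
      = entropy (Fintype.card F) μ fun x => (fW x, (0 : Space F V L LZ →+ Unit) x) :=
    entropy_congr _ _ _ _ fun _ _ => by simp only [Prod.mk.injEq, and_true]
  have h7 : entropy (Fintype.card F) μ fZ
      = entropy (Fintype.card F) μ fun x => (fZ x, (0 : Space F V L LZ →+ Unit) x) :=
    entropy_congr _ _ _ _ fun _ _ => by simp only [Prod.mk.injEq, and_true]
  have h8 : entropy (Fintype.card F) μ (fun x => (fW x, fZ x))
      = entropy (Fintype.card F) μ fun x => (fW x, fZ x, (0 : Space F V L LZ →+ Unit) x) :=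
    entropy_congr _ _ _ _ fun _ _ => by simp only [Prod.mk.injEq, and_true]
  rw [h8]
  linarith

theorem server_condMutualInfo {S T : Finset (User V)} (hS : S ∈ 𝒮) (hT : T ∈ 𝒯) :
    condMutualInfo (Fintype.card F) (PMF.uniformOfFintype (Space F V L LZ))
      (jointHom Finset.univ c.relayMsg) (jointHom S input)
      ((AddMonoidHom.mk' (fun x : Space F V L LZ => ∑ i, x.1 i) fun x y => by
        simp [Finset.sum_add_distrib]).prod ((jointHom T input).prod (jointHom T c.key))) = 0 := by
  refine condMutualInfo_uniform_hom _ _ _ _ fun x hx => ?_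
  simp only [AddMonoidHom.prod_apply, Prod.mk_eq_zero, jointHom_eq_zero_iff] at hx
  obtain ⟨y, h0, h1, h2, h3, h4⟩ := c.exists_server_witness hS hT x hx.2.1
  refine ⟨y, ?_, jointHom_eq_zero_iff.2 fun u _ => h3 u, jointHom_eq_iff.2 h4⟩
  simp only [AddMonoidHom.prod_apply, Prod.mk_eq_zero, jointHom_eq_zero_iff]
  exact ⟨h0, h1, h2⟩

theorem relay_condMutualInfo (u : Fin U) {S T : Finset (User V)} (hS : S ∈ 𝒮) (hT : T ∈ 𝒯) :
    condMutualInfo (Fintype.card F) (PMF.uniformOfFintype (Space F V L LZ))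
      (jointHom (cluster V u) c.userMsg) (jointHom S input)
      ((jointHom T input).prod (jointHom T c.key)) = 0 := by
  refine condMutualInfo_uniform_hom _ _ _ _ fun x hx => ?_
  simp only [AddMonoidHom.prod_apply, Prod.mk_eq_zero, jointHom_eq_zero_iff] at hx
  obtain ⟨y, h1, h2, h3, h4⟩ := c.exists_relay_witness (u := u) hS hT x hx.1
  refine ⟨y, ?_, jointHom_eq_zero_iff.2 h3, jointHom_eq_iff.2 h4⟩
  simp only [AddMonoidHom.prod_apply, Prod.mk_eq_zero, jointHom_eq_zero_iff]
  exact ⟨h1, h2⟩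

/-- The scheme of a linear code. -/
noncomputable def toScheme (hL : 0 < L) : Scheme F V 𝒮 𝒯 where
  Ω := Space F V L LZ
  μ := PMF.uniformOfFintype (Space F V L LZ)
  L := L
  LZ := LZ
  LX := L
  LY := L
  L_pos := hL
  W i := fun x => x.1 i
  Zsrc := fun x => x.2
  Key i := Fin (c.n i) → F
  Z i := fun x => c.G i x.2
  X i := fun x => x.1 i + c.P i (c.G i x.2)
  Y u := fun x => c.relayMsg u x
  W_uniform i := map_input i
  Zsrc_uniform := map_source
  indep := c.entropy_inputs_keys
  key_gen := condEntropy_eq_zero _ _ _ _ fun ω ω' h => by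
    rw [joint_eq_iff]
    intro i _
    rw [h]
  msgX i := condEntropy_eq_zero _ _ _ _ fun ω ω' h => by
    simp only [Prod.mk.injEq] at h
    rw [h.1, h.2]
  msgY u := condEntropy_eq_zero _ _ _ _ fun ω ω' h => by
    rw [joint_eq_iff] at h
    simp only [relayMsg_apply]
    exact Finset.sum_congr rfl h
  recovery := condEntropy_eq_zero _ _ _ _ fun ω ω' h => by
    rw [joint_eq_iff] at h
    rw [← c.sum_relayMsg, ← c.sum_relayMsg]
    exact Finset.sum_congr rfl h
  server_security S hS T hT := c.server_condMutualInfo hS hT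
  relay_security u S hS T hT := c.relay_condMutualInfo u hS hT

theorem keyRate_toScheme (hL : 0 < L) : (c.toScheme hL).keyRate = LZ / L := by
  have h := entropy_of_uniform (Fintype.card F) _ _ (c.toScheme hL).Zsrc_uniform
  rw [log_card_fun_div] at h
  rw [Scheme.keyRate, h]
  rfl

end LinearCode

/-! ### The counting argument behind generic choices. -/

section UnionBound

/-- Fewer homomorphisms than the size of each of their images do not cover the group by their
kernels. -/
theorem exists_forall_apply_ne_zero {M ι : Type*} [AddCommGroup M] [Finite M] [Fintype ι]
    {W : ι → Type*} [∀ i, AddCommGroup (W i)] (f : (i : ι) → M →+ W i)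
    (hf : ∀ i, Function.Surjective (f i)) (hcard : ∀ i, Fintype.card ι < Nat.card (W i)) :
    ∃ x, ∀ i, f i x ≠ 0 := by
  classical
  by_contra! hcon
  have := Fintype.ofFinite M
  have hker : ∀ i, Nat.card (f i).ker * Nat.card (W i) = Fintype.card M := by
    intro i
    rw [← Nat.card_eq_fintype_card, ← (f i).ker.card_mul_index, AddSubgroup.index_ker,
      AddMonoidHom.range_eq_top.2 (hf i)]
    simp
  have hsub : (Finset.univ : Finset M) ⊆
      Finset.univ.biUnion fun i => Finset.univ.filter fun x => f i x = 0 := by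
    intro x _
    obtain ⟨i, hi⟩ := hcon x
    simp only [Finset.mem_biUnion, Finset.mem_filter, Finset.mem_univ, true_and]
    exact ⟨i, hi⟩
  have h1 := (Finset.card_le_card hsub).trans Finset.card_biUnion_le
  have h2 : ∀ i, (Finset.univ.filter fun x => f i x = 0).card = Nat.card (f i).ker := by
    intro i
    rw [Nat.card_eq_fintype_card, Fintype.card_subtype]
    congr 1
    ext x
    simp [AddMonoidHom.mem_ker]
  -- Every kernel has at most a fraction `1 / (Fintype.card ι + 1)` of the group, so the kernels
  -- together cannot fill it.
  have h3 : (∑ i, (Finset.univ.filter fun x => f i x = 0).card) * (Fintype.card ι + 1)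
      ≤ Fintype.card ι * Fintype.card M := by
    rw [Finset.sum_mul]
    refine (Finset.sum_le_card_nsmul _ _ (Fintype.card M) fun i _ => ?_).trans_eq (by simp)
    rw [h2, ← hker i]
    exact Nat.mul_le_mul_left _ (hcard i)
  rw [Finset.card_univ] at h1
  have h4 : 0 < Fintype.card M := Fintype.card_pos
  have h5 := Nat.mul_le_mul_right (Fintype.card ι + 1) h1
  nlinarith

end UnionBound

/-! ### Generic linear maps over an arbitrary finite field. -/

section LinearAlgebra

open Module

variable {F : Type*} [Field F] [Fintype F]

omit [Fintype F] in
theorem exists_dual_ne_zero_of_ne_top {X : Type*} [AddCommGroup X] [Module F X]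
    {p : Submodule F X} (hp : p ≠ ⊤) : ∃ c : Dual F X, c ≠ 0 ∧ ∀ x ∈ p, c x = 0 := by
  obtain ⟨c, hc, h⟩ := Submodule.exists_le_ker_of_lt_top p (lt_top_iff_ne_top.2 hp)
  exact ⟨c, hc, fun x hx => LinearMap.mem_ker.1 (h hx)⟩

omit [Fintype F] in
theorem dual_comp_surjective {X N : Type*} [AddCommGroup X] [Module F X] [AddCommGroup N]
    [Module F N] {c : Dual F X} (hc : c ≠ 0) (w : Dual F N) :
    ∃ G : N →ₗ[F] X, c ∘ₗ G = w := by
  obtain ⟨x, hx⟩ : ∃ x, c x ≠ 0 := by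
    by_contra! h
    exact hc (LinearMap.ext h)
  refine ⟨w.smulRight ((c x)⁻¹ • x), LinearMap.ext fun n => ?_⟩
  simp [hx]

theorem card_dual (X : Type*) [AddCommGroup X] [Module F X] [FiniteDimensional F X] :
    Nat.card (Dual F X) = Fintype.card F ^ finrank F X := by
  rw [Module.natCard_eq_pow_finrank (K := F), Subspace.dual_finrank_eq, Nat.card_eq_fintype_card]

/-- Matrices such that all sufficiently many columns span the target. -/
theorem exists_spanning_family {ι : Type*} [Fintype ι] {K : ι → Type*} {X : Type*}
    [∀ i, AddCommGroup (K i)] [∀ i, Module F (K i)] [∀ i, FiniteDimensional F (K i)]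
    [AddCommGroup X] [Module F X] [FiniteDimensional F X] (m : ℕ) (hm : Fintype.card ι < m) :
    ∃ P : (i : ι) → K i →ₗ[F] X, ∀ e : Finset ι,
      finrank F X + m ≤ ∑ i ∈ e, finrank F (K i) →
      ⨆ i ∈ e, LinearMap.range (P i) = ⊤ := by
  classical
  have hfinX : Finite X := Module.finite_of_finite F
  have hfinK : ∀ i, Finite (K i) := fun i => Module.finite_of_finite F
  have hfinD : Finite (Dual F X) := Module.finite_of_finite F
  have hfinP : ∀ i, Finite (K i →ₗ[F] X) := fun i => Module.finite_of_finite F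
  have := Fintype.ofFinite (Dual F X)
  -- A bad event is a set `e` of columns together with a nonzero functional killing all of them.
  -- There are at most `2 ^ card ι * q ^ finrank X` events, fewer than `q ^ (finrank X + m)` because
  -- `m` exceeds `card ι`.
  let J := {e : Finset ι // finrank F X + m ≤ ∑ i ∈ e, finrank F (K i)} × {c : Dual F X // c ≠ 0}
  let f : (j : J) → ((i : ι) → K i →ₗ[F] X) →+ ((i : j.1.1) → Dual F (K i)) := fun j =>
    AddMonoidHom.mk' (fun P i => j.2.1 ∘ₗ P i) fun P Q => by
      funext i
      exact LinearMap.comp_add _ _ _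
  obtain ⟨P, hP⟩ := exists_forall_apply_ne_zero f (fun j w => by
    choose G hG using fun i => dual_comp_surjective j.2.2 (w i)
    refine ⟨fun i => if h : i ∈ j.1.1 then G ⟨i, h⟩ else 0, ?_⟩
    funext i
    have : f j (fun i => if h : i ∈ j.1.1 then G ⟨i, h⟩ else 0) i
      = j.2.1 ∘ₗ (if h : i.1 ∈ j.1.1 then G ⟨i.1, h⟩ else 0) := rfl
    rw [this, dif_pos i.2]
    exact hG i) (fun j => by
    have h1 : Nat.card ((i : j.1.1) → Dual F (K i))
        = Fintype.card F ^ ∑ i ∈ j.1.1, finrank F (K i) := by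
      rw [Nat.card_pi, ← Finset.prod_pow_eq_pow_sum,
        ← Finset.prod_coe_sort j.1.1 fun i => Fintype.card F ^ finrank F (K i)]
      exact Finset.prod_congr rfl fun i _ => card_dual (F := F) (K i)
    have hq : 1 < Fintype.card F := Fintype.one_lt_card
    rw [h1]
    calc Fintype.card J ≤ 2 ^ Fintype.card ι * Fintype.card F ^ finrank F X := by
          rw [Fintype.card_prod]
          refine Nat.mul_le_mul ?_ ?_
          · rw [← Fintype.card_finset]
            exact Fintype.card_subtype_le _
          · rw [← card_dual X, Nat.card_eq_fintype_card]
            exact Fintype.card_subtype_le _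
      _ < Fintype.card F ^ m * Fintype.card F ^ finrank F X := by
          refine Nat.mul_lt_mul_of_pos_right ?_ (by positivity)
          exact (Nat.pow_lt_pow_right (by norm_num) hm).trans_le (Nat.pow_le_pow_left hq m)
      _ = Fintype.card F ^ (finrank F X + m) := by rw [← pow_add, add_comm]
      _ ≤ _ := Nat.pow_le_pow_right (by omega) j.1.2)
  refine ⟨P, fun e he => ?_⟩
  by_contra hne
  obtain ⟨c, hc, h⟩ := exists_dual_ne_zero_of_ne_top hne
  refine hP (⟨e, he⟩, ⟨c, hc⟩) ?_
  funext i
  refine LinearMap.ext fun k => h _ ?_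
  exact Submodule.mem_iSup_of_mem i.1 (Submodule.mem_iSup_of_mem i.2 ⟨k, rfl⟩)

/-- A linear map of large rank that is transversal to finitely many subspaces. -/
theorem exists_transversal {J Y N : Type*} [Fintype J] [AddCommGroup Y] [Module F Y]
    [FiniteDimensional F Y] [AddCommGroup N] [Module F N] [FiniteDimensional F N]
    (D : J → Submodule F Y)
    (hD : ∀ j, finrank F (Y ⧸ D j) + Fintype.card J ≤ finrank F N) :
    ∃ G : N →ₗ[F] Y, ∀ j, LinearMap.range G ⊔ D j = ⊤ := by
  classical
  have hfinY : Finite Y := Module.finite_of_finite F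
  have hfinG : Finite (N →ₗ[F] Y) := Module.finite_of_finite F
  have hfinD : ∀ j, Finite (Dual F (Y ⧸ D j)) := fun j => Module.finite_of_finite F
  have := fun j => Fintype.ofFinite (Dual F (Y ⧸ D j))
  -- Failure at `j` is witnessed by a nonzero functional that kills both `D j` and the range of `G`.
  -- Since `card J < q ^ card J`, a spare `card J` dimensions of `N` outweigh all these functionals.
  let I := (j : J) × {c : Dual F (Y ⧸ D j) // c ≠ 0}
  let f : (i : I) → (N →ₗ[F] Y) →+ Dual F N := fun i =>
    AddMonoidHom.mk' (fun G => (i.2.1 ∘ₗ (D i.1).mkQ) ∘ₗ G) fun P Q => LinearMap.comp_add _ _ _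
  obtain ⟨G, hG⟩ := exists_forall_apply_ne_zero f (fun i w => dual_comp_surjective (fun h0 => by
      refine i.2.2 (LinearMap.ext fun y => ?_)
      obtain ⟨y, rfl⟩ := (D i.1).mkQ_surjective y
      exact LinearMap.congr_fun h0 y) w) (fun i => by
    rw [card_dual]
    have hq : 1 < Fintype.card F := Fintype.one_lt_card
    have hJ : Fintype.card J ≤ finrank F N := le_trans (Nat.le_add_left _ _) (hD i.1)
    calc Fintype.card I = ∑ j, Fintype.card {c : Dual F (Y ⧸ D j) // c ≠ 0} := Fintype.card_sigma
      _ ≤ ∑ j : J, Fintype.card F ^ (finrank F N - Fintype.card J) := by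
          refine Finset.sum_le_sum fun j _ => (Fintype.card_subtype_le _).trans ?_
          rw [← Nat.card_eq_fintype_card, card_dual]
          have := hD j
          exact Nat.pow_le_pow_right (by omega) (by omega)
      _ = Fintype.card J * Fintype.card F ^ (finrank F N - Fintype.card J) := by simp
      _ < Fintype.card F ^ Fintype.card J * Fintype.card F ^ (finrank F N - Fintype.card J) :=
          Nat.mul_lt_mul_of_pos_right (Nat.lt_pow_self hq) (by positivity)
      _ = Fintype.card F ^ finrank F N := by rw [← pow_add, Nat.add_sub_cancel' hJ])
  refine ⟨G, fun j => ?_⟩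
  by_contra hne
  obtain ⟨c, hc, h⟩ := exists_dual_ne_zero_of_ne_top hne
  have hcD : D j ≤ LinearMap.ker c := fun y hy => h y (Submodule.mem_sup_right hy)
  refine hG ⟨j, (D j).liftQ c hcD, fun h0 => hc ?_⟩ ?_
  · rw [← (D j).liftQ_mkQ c hcD, h0, LinearMap.zero_comp]
  · refine LinearMap.ext fun n => ?_
    exact h _ (Submodule.mem_sup_left ⟨n, rfl⟩)

omit [Fintype F] in
theorem comp_surjective_of_transversal {Y N Q : Type*} [AddCommGroup Y] [Module F Y]
    [AddCommGroup N] [Module F N] [AddCommGroup Q] [Module F Q] {A : Y →ₗ[F] Q}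
    (hA : Function.Surjective A) {G : N →ₗ[F] Y}
    (hG : LinearMap.range G ⊔ LinearMap.ker A = ⊤) (q : Q) : ∃ n, A (G n) = q := by
  obtain ⟨y, rfl⟩ := hA q
  obtain ⟨_, ⟨n, rfl⟩, d, hd, hy⟩ := Submodule.mem_sup.1 (hG ▸ Submodule.mem_top : y ∈ _)
  refine ⟨n, ?_⟩
  rw [← hy, map_add, LinearMap.mem_ker.1 hd, add_zero]

omit [Fintype F] in
/-- Any vector can be corrected outside `C` to lie in the kernel. -/
theorem exists_mem_ker_eqOn {ι : Type*} [Fintype ι] [DecidableEq ι] {K : ι → Type*} {X : Type*}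
    [∀ i, AddCommGroup (K i)] [∀ i, Module F (K i)] [AddCommGroup X] [Module F X]
    {P : (i : ι) → K i →ₗ[F] X} {C : Finset ι} (hC : ⨆ i ∈ Cᶜ, LinearMap.range (P i) = ⊤)
    (k : (i : ι) → K i) : ∃ y : (i : ι) → K i, ∑ i, P i (y i) = 0 ∧ ∀ i ∈ C, y i = k i := by
  have hmem : - ∑ i ∈ C, P i (k i) ∈ ⨆ i ∈ Cᶜ, LinearMap.range (P i) :=
    hC ▸ Submodule.mem_top
  obtain ⟨μ, hμ⟩ := (Submodule.mem_iSup_finset_iff_exists_sum _ _).1 hmem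
  choose κ hκ using fun i => (μ i).2
  refine ⟨fun i => if i ∈ C then k i else κ i, ?_, fun i hi => if_pos hi⟩
  have h1 : ∑ i ∈ C, P i (if i ∈ C then k i else κ i) = ∑ i ∈ C, P i (k i) :=
    Finset.sum_congr rfl fun i hi => by rw [if_pos hi]
  have h2 : ∑ i ∈ Cᶜ, P i (if i ∈ C then k i else κ i) = ∑ i ∈ Cᶜ, (μ i : X) :=
    Finset.sum_congr rfl fun i hi => by rw [if_neg (Finset.mem_compl.1 hi), hκ]
  rw [← Finset.sum_add_sum_compl C, h1, h2, hμ, add_neg_cancel]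

end LinearAlgebra

/-! ### Linear codes from dimension counts. -/

open Module

section

variable {F : Type u} [Field F] [Fintype F] {U : ℕ} {V : Fin U → ℕ}
  {𝒮 𝒯 : Finset (Finset (User V))}

/-- The number of security constraints. -/
def numConstraints (𝒮 𝒯 : Finset (Finset (User V))) : ℕ :=
  (triples V 𝒮 𝒯).card + (𝒮 ×ˢ 𝒯).card

/-- Keys are drawn from the space `Y` of tuples whose masks sum to zero. Lower bounds on key lengths
make the columns outside each cover span, so any values on the cover extend to a point of `Y`. Upper
bounds by `LZ` leave room for a generic map from the source key into `Y` to remain surjective onto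
every security constraint. -/
theorem exists_linearCode_of_dims {L LZ m : ℕ} (n : User V → ℕ)
    (hm : Fintype.card (User V) < m)
    (hrelay : ∀ u, ∀ S ∈ 𝒮, ∀ T ∈ 𝒯, L + m ≤ ∑ i ∈ (relayCover V u S T)ᶜ, n i)
    (hserver : ∀ S ∈ 𝒮, ∀ T ∈ 𝒯, L + m ≤ ∑ i ∈ (serverCover V (S \ T) T)ᶜ, n i)
    (hexp : ∀ i ∈ explicitSet V 𝒮, L + m ≤ n i)
    (drelay : ∀ u, ∀ S ∈ 𝒮, ∀ T ∈ 𝒯,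
      ∑ i ∈ relayCover V u S T, n i + numConstraints 𝒮 𝒯 ≤ LZ)
    (dserver : ∀ S ∈ 𝒮, ∀ T ∈ 𝒯, ∑ i ∈ T, n i + (securityRelays V (S \ T) T).card * L
      + numConstraints 𝒮 𝒯 ≤ LZ) :
    Nonempty (LinearCode F V 𝒮 𝒯 L LZ) := by
  classical
  obtain ⟨P, hP⟩ := exists_spanning_family (F := F) (K := fun i => Fin (n i) → F)
    (X := Fin L → F) m hm
  simp only [finrank_fin_fun] at hP
  have hPsurj : ∀ i ∈ explicitSet V 𝒮, Function.Surjective (P i) := by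
    intro i hi
    have := hP {i} (by simpa using hexp i hi)
    rw [← LinearMap.range_eq_top]
    simpa using this
  let Y : Submodule F ((i : User V) → Fin (n i) → F) :=
    LinearMap.ker (∑ i, P i ∘ₗ LinearMap.proj i)
  have hY : ∀ y, y ∈ Y ↔ ∑ i, P i (y i) = 0 := fun y => by
    simp [Y, LinearMap.mem_ker, LinearMap.sum_apply]
  let A₁ : (C : Finset (User V)) → Y →ₗ[F] ((i : C) → Fin (n i) → F) := fun C =>
    LinearMap.pi fun i => LinearMap.proj i.1 ∘ₗ Y.subtype
  let A₂ : (p : Finset (User V) × Finset (User V)) → Y →ₗ[F] ((i : p.2) → Fin (n i) → F) ×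
      ((securityRelays V (p.1 \ p.2) p.2 : Finset (Fin U)) → Fin L → F) := fun p =>
    (A₁ p.2).prod (LinearMap.pi fun u => (∑ i ∈ cluster V u.1 \ p.2, P i ∘ₗ LinearMap.proj i) ∘ₗ
      Y.subtype)
  have hA₁ : ∀ u, ∀ S ∈ 𝒮, ∀ T ∈ 𝒯, Function.Surjective (A₁ (relayCover V u S T)) := by
    intro u S hS T hT k
    obtain ⟨y, hy0, hy⟩ := exists_mem_ker_eqOn (hP _ (hrelay u S hS T hT))
      (fun i => if h : i ∈ relayCover V u S T then k ⟨i, h⟩ else 0)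
    refine ⟨⟨y, (hY y).2 hy0⟩, ?_⟩
    funext i
    exact (hy i i.2).trans (dif_pos i.2)
  have hA₂ : ∀ S ∈ 𝒮, ∀ T ∈ 𝒯, Function.Surjective (A₂ (S, T)) := by
    rintro S hS T hT ⟨k, x⟩
    -- One user of `S \ T` in the cluster suffices to realise any relay sum, since its own `P j` is
    -- surjective.
    have hd : ∀ u : securityRelays V (S \ T) T, ∃ d : (i : User V) → Fin (n i) → F,
        ∑ i ∈ cluster V u.1 \ T, P i (d i) = x u := by
      intro u
      obtain ⟨⟨j, hj⟩, -⟩ := mem_securityRelays.1 u.2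
      obtain ⟨κ, hκ⟩ := hPsurj j (SchemeEntropy.subset_explicit hS (by grind)) (x u)
      refine ⟨Pi.single j κ, ?_⟩
      rw [Finset.sum_eq_single_of_mem j (by grind) fun i _ hij => by
        rw [Pi.single_eq_of_ne hij, map_zero], Pi.single_eq_same, hκ]
    choose d hd using hd
    obtain ⟨y, hy0, hy⟩ := exists_mem_ker_eqOn (hP _ (hserver S hS T hT))
      (fun i => if h : i ∈ T then k ⟨i, h⟩ else
        if h : i.1 ∈ securityRelays V (S \ T) T then d ⟨i.1, h⟩ i else 0)
    refine ⟨⟨y, (hY y).2 hy0⟩, ?_⟩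
    refine Prod.ext ?_ ?_
    · funext i
      exact (hy i.1 (subset_serverCover _ _ i.2)).trans (dif_pos i.2)
    · funext u
      have h1 : (A₂ (S, T) ⟨y, (hY y).2 hy0⟩).2 u = ∑ i ∈ cluster V u.1 \ T, P i (y i) := by
        simp [A₂]
      rw [h1]
      refine Eq.trans ?_ (hd u)
      refine Finset.sum_congr rfl fun i hi => ?_
      obtain ⟨hi1, hi2⟩ := Finset.mem_sdiff.1 hi
      obtain ⟨u, hu⟩ := u
      have hiu := mem_cluster.1 hi1
      subst hiu
      rw [hy i (Finset.mem_union_left _ (mem_clusters.2 hu)), dif_neg hi2, dif_pos hu]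
  obtain ⟨G, hG⟩ := exists_transversal (F := F) (N := Fin LZ → F)
    (J := {p // p ∈ triples V 𝒮 𝒯} ⊕ {p // p ∈ 𝒮 ×ˢ 𝒯})
    (Sum.elim (fun p => LinearMap.ker (A₁ (relayCover V p.1.1 p.1.2.1 p.1.2.2)))
      (fun p => LinearMap.ker (A₂ p.1))) (by
    have hcard : Fintype.card ({p // p ∈ triples V 𝒮 𝒯} ⊕ {p // p ∈ 𝒮 ×ˢ 𝒯})
        = numConstraints 𝒮 𝒯 := by
      rw [Fintype.card_sum, Fintype.card_coe, Fintype.card_coe, numConstraints]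
    rw [hcard, finrank_fin_fun]
    rintro (⟨⟨u, S, T⟩, hp⟩ | ⟨⟨S, T⟩, hp⟩)
    · rw [triples, Finset.mem_product, Finset.mem_product] at hp
      refine le_trans (Nat.add_le_add_right ?_ _) (drelay u S hp.2.1 T hp.2.2)
      refine ((A₁ (relayCover V u S T)).quotKerEquivOfSurjective
        (hA₁ u S hp.2.1 T hp.2.2)).finrank_eq.trans_le ?_
      rw [finrank_pi_fintype]
      simp only [finrank_fin_fun]
      rw [Finset.sum_coe_sort (relayCover V u S T) n]
    · rw [Finset.mem_product] at hp
      refine le_trans (Nat.add_le_add_right ?_ _) (dserver S hp.1 T hp.2)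
      refine ((A₂ (S, T)).quotKerEquivOfSurjective (hA₂ S hp.1 T hp.2)).finrank_eq.trans_le ?_
      rw [finrank_prod, finrank_pi_fintype, finrank_pi_fintype]
      simp only [finrank_fin_fun]
      rw [Finset.sum_coe_sort T n]
      simp)
  refine ⟨⟨n, P, fun i => LinearMap.proj i ∘ₗ Y.subtype ∘ₗ G, fun N => (hY _).1 (G N).2, ?_, ?_⟩⟩
  · intro u S hS T hT w
    have hk : ∀ i, ∃ k : Fin (n i) → F, (i ∈ T → k = 0) ∧
        (i ∈ (S ∩ cluster V u) \ T → P i k = w i) := by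
      intro i
      by_cases hi : i ∈ (S ∩ cluster V u) \ T
      · obtain ⟨k, hk⟩ := hPsurj i (SchemeEntropy.subset_explicit hS (by grind)) (w i)
        exact ⟨k, fun h => absurd h (Finset.mem_sdiff.1 hi).2, fun _ => hk⟩
      · exact ⟨0, fun _ => rfl, fun h => absurd h hi⟩
    choose k hk1 hk2 using hk
    have hp : (u, S, T) ∈ triples V 𝒮 𝒯 := by
      rw [triples, Finset.mem_product, Finset.mem_product]
      exact ⟨Finset.mem_univ u, hS, hT⟩
    obtain ⟨N, hN⟩ := comp_surjective_of_transversal (hA₁ u S hS T hT)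
      (hG (Sum.inl ⟨(u, S, T), hp⟩)) (fun i => k i)
    have hN' : ∀ i ∈ relayCover V u S T, (G N).1 i = k i := fun i hi => congrFun hN ⟨i, hi⟩
    refine ⟨N, fun i hi => ?_, fun i hi => ?_⟩
    · exact (hN' i (subset_relayCover u S T hi)).trans (hk1 i hi)
    · refine (congrArg (P i) (hN' i ?_)).trans (hk2 i hi)
      exact Finset.mem_union_left _ (Finset.mem_sdiff.1 hi).1
  · intro S hS T hT w
    obtain ⟨N, hN⟩ := comp_surjective_of_transversal (hA₂ S hS T hT)
      (hG (Sum.inr ⟨(S, T), Finset.mem_product.2 ⟨hS, hT⟩⟩)) (0, fun u => w u)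
    refine ⟨N, fun i hi => congrFun (congrArg Prod.fst hN) ⟨i, hi⟩, fun u hu => ?_⟩
    have h1 : (A₂ (S, T) (G N)).2 ⟨u, hu⟩ = ∑ i ∈ cluster V u \ T, P i ((G N).1 i) := by
      simp [A₂]
    exact h1.symm.trans (congrFun (congrArg Prod.snd hN) ⟨u, hu⟩)

end

/-! ### Key lengths from the linear program, and vanishing overhead. -/

section Achievability

variable {F : Type u} [Field F] [Fintype F] {U : ℕ} {V : Fin U → ℕ}
  {𝒮 𝒯 : Finset (Finset (User V))}

/-- The key lengths of the users: full length on the total security set, and lengths proportional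
to the weights `l` elsewhere, with `m` symbols to spare. -/
noncomputable def keyLength (𝒮 𝒯 : Finset (Finset (User V))) (l : User V → ℝ) (L m : ℕ)
    (i : User V) : ℕ :=
  if i ∈ totalSet V 𝒮 𝒯 then L + m else ⌈l i * L⌉₊ + m

/-- A user of the total set outside `C` alone supplies `L + m` symbols. If there is none, the linear
program's constraint supplies `L`, and the non-empty complement supplies at least one spare `m`. -/
theorem le_sum_keyLength_compl {l : User V → ℝ} {L m : ℕ} {C : Finset (User V)}
    (hC : totalSet V 𝒮 𝒯 ⊆ C → 1 ≤ ∑ i ∈ Cᶜ, l i) :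
    L + m ≤ ∑ i ∈ Cᶜ, keyLength 𝒮 𝒯 l L m i := by
  by_cases hsub : totalSet V 𝒮 𝒯 ⊆ C
  · have h1 := hC hsub
    have hne : Cᶜ.Nonempty := by
      rw [Finset.nonempty_iff_ne_empty]
      intro h0
      rw [h0, Finset.sum_empty] at h1
      norm_num at h1
    have h2 : ∀ i ∈ Cᶜ, l i * L + m ≤ (keyLength 𝒮 𝒯 l L m i : ℝ) := by
      intro i hi
      have : i ∉ totalSet V 𝒮 𝒯 := fun h => (Finset.mem_compl.1 hi) (hsub h)
      rw [keyLength, if_neg this]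
      push_cast
      have := Nat.le_ceil (l i * L)
      linarith
    have h3 := Finset.sum_le_sum h2
    rw [Finset.sum_add_distrib, ← Finset.sum_mul, Finset.sum_const, nsmul_eq_mul] at h3
    have h4 : (1 : ℝ) ≤ Cᶜ.card := by exact_mod_cast Finset.card_pos.2 hne
    have h5 : (L : ℝ) ≤ (∑ i ∈ Cᶜ, l i) * L := le_mul_of_one_le_left (Nat.cast_nonneg L) h1
    have h6 : (m : ℝ) ≤ Cᶜ.card * m := le_mul_of_one_le_left (Nat.cast_nonneg m) h4
    have h7 : ((L + m : ℕ) : ℝ) ≤ ((∑ i ∈ Cᶜ, keyLength 𝒮 𝒯 l L m i : ℕ) : ℝ) := by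
      push_cast
      linarith
    exact_mod_cast h7
  · obtain ⟨i, hi, hiC⟩ := Finset.not_subset.1 hsub
    calc L + m = keyLength 𝒮 𝒯 l L m i := by rw [keyLength, if_pos hi]
      _ ≤ _ := Finset.single_le_sum (fun _ _ => Nat.zero_le _) (Finset.mem_compl.2 hiC)

theorem sum_keyLength_le {l : User V → ℝ} {L m : ℕ} (C : Finset (User V)) :
    ∑ i ∈ C, keyLength 𝒮 𝒯 l L m i ≤ (C ∩ totalSet V 𝒮 𝒯).card * (L + m)
      + ∑ i ∈ (totalSet V 𝒮 𝒯)ᶜ, keyLength 𝒮 𝒯 l L m i := by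
  rw [← Finset.sum_inter_add_sum_sdiff C (totalSet V 𝒮 𝒯)]
  refine Nat.add_le_add ?_ ?_
  · rw [← smul_eq_mul, ← Finset.sum_const]
    refine Finset.sum_le_sum fun i hi => ?_
    rw [keyLength, if_pos (Finset.mem_inter.1 hi).2]
  · refine Finset.sum_le_sum_of_subset fun i hi => ?_
    exact Finset.mem_compl.2 (Finset.mem_sdiff.1 hi).2

theorem card_inter_total {C : Finset (User V)} (h : totalSet V 𝒮 𝒯 ⊆ C) :
    (C ∩ totalSet V 𝒮 𝒯).card = (totalSet V 𝒮 𝒯).card := by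
  rw [Finset.inter_eq_right.2 h]

/-- Any feasible point of the linear program gives linear codes of the corresponding length. -/
theorem exists_linearCode (h𝒮 : ∀ S ∈ 𝒮, ∀ S' ⊆ S, S' ∈ 𝒮) {l : User V → ℝ}
    (hl : LPFeasible V 𝒮 𝒯 l) (L m : ℕ) (hm : Fintype.card (User V) < m) :
    Nonempty (LinearCode F V 𝒮 𝒯 L (max (aStar V 𝒮 𝒯) (dStar V 𝒮 𝒯) * (L + m)
      + ∑ i ∈ (totalSet V 𝒮 𝒯)ᶜ, keyLength 𝒮 𝒯 l L m i + numConstraints 𝒮 𝒯)) := by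
  refine exists_linearCode_of_dims (keyLength 𝒮 𝒯 l L m) hm ?_ ?_ ?_ ?_ ?_
  · intro u S hS T hT
    exact le_sum_keyLength_compl fun h => hl.relay u S hS T hT (card_inter_total h)
  · intro S hS T hT
    have hS' := h𝒮 S hS _ (Finset.sdiff_subset (t := T))
    exact le_sum_keyLength_compl fun h => hl.server _ hS' T hT (card_inter_total h)
  · intro i hi
    have ht : i ∈ totalSet V 𝒮 𝒯 := Finset.mem_union_left _ hi
    rw [keyLength, if_pos ht]
  · intro u S hS T hT
    refine Nat.add_le_add_right ((sum_keyLength_le _).trans (Nat.add_le_add_right ?_ _)) _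
    exact Nat.mul_le_mul_right _ ((card_setA_le_aStar hS hT).trans (le_max_left _ _))
  · intro S hS T hT
    have hS' := h𝒮 S hS _ (Finset.sdiff_subset (t := T))
    -- `dStar` only ranges over disjoint pairs, so `S` is replaced by `S \ T`, again a security set.
    have hd := (dValue_le_dStar hS' hT (Finset.sdiff_inter_self T S)).trans
      (le_max_right (aStar V 𝒮 𝒯) _)
    have h1 := sum_keyLength_le (𝒮 := 𝒮) (𝒯 := 𝒯) (l := l) (L := L) (m := m) T
    have h2 : (securityRelays V (S \ T) T).card * L
        ≤ (securityRelays V (S \ T) T).card * (L + m) :=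
      Nat.mul_le_mul_left _ (Nat.le_add_right _ _)
    have h3 := Nat.mul_le_mul_right (L + m) hd
    rw [dValue, Nat.add_mul] at h3
    omega

theorem sum_keyLength_total_le {l : User V → ℝ} (hl : LPFeasible V 𝒮 𝒯 l) (L m : ℕ) :
    ((∑ i ∈ (totalSet V 𝒮 𝒯)ᶜ, keyLength 𝒮 𝒯 l L m i : ℕ) : ℝ)
      ≤ (∑ i ∈ (totalSet V 𝒮 𝒯)ᶜ, l i) * L + Fintype.card (User V) * (m + 1) := by
  have h1 : ∀ i ∈ (totalSet V 𝒮 𝒯)ᶜ, (keyLength 𝒮 𝒯 l L m i : ℝ) ≤ l i * L + (m + 1) := by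
    intro i hi
    rw [keyLength, if_neg (Finset.mem_compl.1 hi)]
    push_cast
    have := Nat.ceil_lt_add_one (mul_nonneg (hl.nonneg i hi) (Nat.cast_nonneg (α := ℝ) L))
    linarith
  have h2 := Finset.sum_le_sum h1
  rw [Finset.sum_add_distrib, ← Finset.sum_mul, Finset.sum_const, nsmul_eq_mul] at h2
  have h3 : ((totalSet V 𝒮 𝒯)ᶜ.card : ℝ) ≤ Fintype.card (User V) := by
    exact_mod_cast Finset.card_le_univ _
  have h4 := mul_le_mul_of_nonneg_right h3 (by positivity : (0 : ℝ) ≤ m + 1)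
  push_cast
  linarith

/-- Feasible points of the linear program give schemes of nearly the corresponding rate. -/
theorem exists_keyRate_le (h𝒮 : ∀ S ∈ 𝒮, ∀ S' ⊆ S, S' ∈ 𝒮) {l : User V → ℝ}
    (hl : LPFeasible V 𝒮 𝒯 l) {ε : ℝ} (hε : 0 < ε) :
    ∃ s : Scheme F V 𝒮 𝒯, s.keyRate ≤ ((max (aStar V 𝒮 𝒯) (dStar V 𝒮 𝒯) : ℕ) : ℝ)
      + ∑ i ∈ (totalSet V 𝒮 𝒯)ᶜ, l i + ε := by
  have hcode := fun L m => exists_linearCode (F := F) h𝒮 hl L m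
  generalize max (aStar V 𝒮 𝒯) (dStar V 𝒮 𝒯) = D at hcode ⊢
  generalize hm : Fintype.card (User V) + 1 = m
  -- `c` collects everything that does not grow with `L`: spare symbols, rounding and the number of
  -- constraints. Any `L > c / ε` makes its share of the rate less than `ε`.
  obtain ⟨c, hc⟩ : ∃ c : ℝ, c = D * m + Fintype.card (User V) * (m + 1) + numConstraints 𝒮 𝒯 :=
    ⟨_, rfl⟩
  obtain ⟨L, hL⟩ := exists_nat_gt (c / ε)
  have hc0 : 0 ≤ c := hc ▸ by positivity
  have hL0 : (0 : ℝ) < L := (div_nonneg hc0 hε.le).trans_lt hL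
  have hL' : 0 < L := by exact_mod_cast hL0
  obtain ⟨code⟩ := hcode L m (hm ▸ Nat.lt_succ_self _)
  refine ⟨code.toScheme hL', ?_⟩
  rw [code.keyRate_toScheme hL', div_le_iff₀ hL0]
  have h1 := sum_keyLength_total_le hl L m
  rw [div_lt_iff₀ hε] at hL
  push_cast at h1 ⊢
  nlinarith

end Achievability

end WSHSA

/-! ### Assembly of the bounds. -/

theorem theorem3 {F : Type*} [Field F] [Fintype F] {U : ℕ} (hU : 2 ≤ U) (V : Fin U → ℕ)
    (𝒮 𝒯 : Finset (Finset (WSHSA.User V)))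
    (h𝒮 : 𝒮.Nonempty) (h𝒯 : 𝒯.Nonempty)
    (h𝒮_mono : ∀ S ∈ 𝒮, ∀ S' ⊆ S, S' ∈ 𝒮)
    (h𝒯_mono : ∀ T ∈ 𝒯, ∀ T' ⊆ T, T' ∈ 𝒯)
    (h𝒯_card : ∀ T ∈ 𝒯, T.card + 2 ≤ WSHSA.numUsers V)
    (hC : WSHSA.Condition3 V 𝒮 𝒯) :
    IsLeast (WSHSA.lpValues V 𝒮 𝒯) (WSHSA.lStar V 𝒮 𝒯) ∧
    (WSHSA.achievableKeyRates F V 𝒮 𝒯).Nonempty ∧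
    ((max (WSHSA.aStar V 𝒮 𝒯) (WSHSA.dStar V 𝒮 𝒯) : ℕ) : ℝ)
      ≤ WSHSA.optimalKeyRate F V 𝒮 𝒯 ∧
    WSHSA.optimalKeyRate F V 𝒮 𝒯
      ≤ ((max (WSHSA.aStar V 𝒮 𝒯) (WSHSA.dStar V 𝒮 𝒯) : ℕ) : ℝ) + WSHSA.lStar V 𝒮 𝒯 ∧
    ((∃ S ∈ 𝒮, S.Nonempty) →
      ((max (WSHSA.aStar V 𝒮 𝒯) (WSHSA.dStar V 𝒮 𝒯) : ℕ) : ℝ) + WSHSA.lStar V 𝒮 𝒯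
        ≤ 2 * WSHSA.optimalKeyRate F V 𝒮 𝒯) := by
  have hleast := WSHSA.isLeast_lStar h𝒯_mono hC
  obtain ⟨l, hl, hlstar⟩ := hleast.1
  have hne : (WSHSA.achievableKeyRates F V 𝒮 𝒯).Nonempty := by
    obtain ⟨s, -⟩ := WSHSA.exists_keyRate_le (F := F) h𝒮_mono hl one_pos
    exact ⟨_, s, rfl⟩
  have hlow : ∀ x ∈ WSHSA.achievableKeyRates F V 𝒮 𝒯,
      ((max (WSHSA.aStar V 𝒮 𝒯) (WSHSA.dStar V 𝒮 𝒯) : ℕ) : ℝ) ≤ x := by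
    rintro _ ⟨s, rfl⟩
    rw [Nat.cast_max]
    exact max_le (s.schemeEntropy.aStar_le_rate h𝒮_mono h𝒯_mono h𝒯_card)
      (s.schemeEntropy.dStar_le_rate h𝒮_mono h𝒯_mono h𝒯_card hC.cover_lt)
  have hlow' := le_csInf hne hlow
  refine ⟨hleast, hne, hlow', ?_, fun hS => ?_⟩
  · refine le_of_forall_pos_le_add fun ε hε => ?_
    obtain ⟨s, hs⟩ := WSHSA.exists_keyRate_le (F := F) h𝒮_mono hl hε
    rw [hlstar]
    exact (csInf_le ⟨_, hlow⟩ ⟨s, rfl⟩).trans hs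
  · have hlp : WSHSA.lStar V 𝒮 𝒯 ≤ WSHSA.optimalKeyRate F V 𝒮 𝒯 := by
      refine le_csInf hne ?_
      rintro _ ⟨s, rfl⟩
      obtain ⟨x, hx, hxR⟩ :=
        s.schemeEntropy.exists_lpValue_le h𝒮_mono h𝒯_mono hC.cover_lt hS
      exact (hleast.2 hx).trans hxR
    unfold WSHSA.optimalKeyRate at *
    linarith
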